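/- **Conventions.** Consider three players with a common finite input alphabet $X$ and a common finite output alphabet $A$ (so $N=|X|$ inputs and $K=|A|$ outputs per player). A behaviour is a conditional distribution $P(a,b,c|x,y,z)$. * $\mathcal{BL}^3_{\mathcal G}$ (general bilocal behaviours) is the set of all finite convex mixtures of behaviours of the forms $Q(a|x)R(b,c|y,z)$, $Q(b|y)R(a,c|x,z)$ and $Q(c|z)R(a,b|x,y)$, where $Q$ and $R$ are arbitrary (possibly signalling) conditional distributions. * $\mathcal Q^3$ (quantum behaviours) is the set of all $P(a,b,c|x,y,z)=\langle\psi|E_{a,x}\otimes F_{b,y}\otimes H_{c,z}|\psi\rangle$ with $\psi$ a unit vector of $\mathbb C^{d_1}\otimes\mathbb C^{d_2}\otimes\mathbb C^{d_3}$, $d_1,d_2,d_3$ arbitrary, and $(E_{a,x})_a$, $(F_{b,y})_b$, $(H_{c,z})_c$ POVMs. $\mathcal Q^3_d$ is the subset obtained when at least one of the three local dimensions is at most $d$. * A tripartite game is a table $G=(G_{xyz}^{abc})$ of non-negative numbers with $\sum_{x,y,z}\max_{a,b,c}G_{xyz}^{abc}\le 1$. Put $\langle G,P\rangle=\sum G_{xyz}^{abc}P(a,b,c|x,y,z)$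 and $\omega_{\mathcal S}(G)=\sup_{P\in\mathcal S}|\langle G,P\rangle|$. **The game.** Let $n=2^l$, $l\ge 1$, index the coordinates of $\{0,1\}^n$ by $\{0,1\}^l$, and let $H\le\{0,1\}^n$ be the Hadamard subgroup $\{(s\cdot t)_{t\in\{0,1\}^l}: s\in\{0,1\}^l\}$. In the Khot–Vishnoi game $G_{KV}$ with noise rate $\eta$, a uniformly random coset $[u]\in\{0,1\}^n/H$ and a vector $z\in\{0,1\}^n$, whose coordinates are independent and equal to $1$ with probability $\eta$, are drawn. Alice is asked $[u]$ and Bob is asked $[u\oplus z]$. Each answers an element of the coset received (labelled by one of $n$ labels), $a$ and $b$ respectively, and they win if and only if $a\oplus b=z$; the coefficient $(G_{KV})_{xy}^{ab}$ is the probability that $x,y$ are asked and the pair $a,b$ wins. Fix a base $\beta>1$ of the logarithm (for example $2$ or $e$) and let $\eta=\frac12-\frac1{\log_\beta n}$, for those $n$ for which $\eta\ge 0$. Let $\hat G$ be the tripartite game in which each pair of players plays one instance: $$\hat G_{x_1x_2y_1y_2z_1z_2}^{a_1a_2b_1b_2c_1c_2}=(G_{KV})_{x_1y_1}^{a_1b_1}(G_{KV})_{x_2z_1}^{a_2c_1}(G_{KV})_{y_2z_2}^{b_2c_2}.$$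 **Theorem.** 1. For every base $\beta>1$ there is a constant $C>0$ (depending on $\beta$ only) such that for all $n=2^l$, $l\ge1$, with $\eta\ge0$, the table $\hat G$ is a tripartite game with $(2^n/n)^2$ inputs and $n^2$ outputs per player, $\omega_{\mathcal{BL}^3_{\mathcal G}}(\hat G)>0$, and $$\frac{\omega_{\mathcal Q^3}(\hat G)}{\omega_{\mathcal{BL}^3_{\mathcal G}}(\hat G)}\ \ge\ C\,\frac{n^2}{\ln^6 n}.$$ Moreover, this lower bound is attained with local dimension $n^2$: there is a quantum behaviour $P$ given by a state in $\mathbb C^{n^2}\otimes\mathbb C^{n^2}\otimes\mathbb C^{n^2}$ such that $|\langle\hat G,P\rangle|/\omega_{\mathcal{BL}^3_{\mathcal G}}(\hat G)\ge C n^2/\ln^6 n$. In particular, the ratio $\omega_{\mathcal Q^3}(\hat G)/\omega_{\mathcal{BL}^3_{\mathcal G}}(\hat G)$ tends to infinity as $l\to\infty$. 2. The estimate is optimal, up to the logarithmic factor, in the local dimension and in the number of outputs: for every tripartite game $G$ and every $d$, $$\omega_{\mathcal Q^3_d}(G)\le d\,\omega_{\mathcal{BL}^3_{\mathcal G}}(G),$$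 and for every tripartite game $G$ with $K$ outputs per player, $$\omega_{\mathcal Q^3}(G)\le K\,\omega_{\mathcal{BL}^3_{\mathcal G}}(G).$$ -/

import Mathlib

open scoped Matrix Kronecker ComplexOrder

noncomputable section

/-! ### Behaviours, Bell functionals and games

All players share one input alphabet `X` and one output alphabet `A`. -/

/-- A table of real numbers indexed by the inputs `x y z` and the outputs `a b c` of three players.
It is used both for behaviours, where `P x y z a b c` is `P(a,b,c|x,y,z)`, and for Bell
functionals, where `M x y z a b c` is the coefficient `M_{xyz}^{abc}`. -/
abbrev Table₃ (X A : Type*) : Type _ := X → X → X → A → A → A → ℝ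

/-- The bipartite analogue: `G x y a b` is the coefficient `G_{xy}^{ab}`. -/
abbrev Table₂ (X A : Type*) : Type _ := X → X → A → A → ℝ

/-- The action of a tripartite Bell functional on a tripartite behaviour. -/
def pairing {X A : Type*} [Fintype X] [Fintype A] (M P : Table₃ X A) : ℝ :=
  ∑ x, ∑ y, ∑ z, ∑ a, ∑ b, ∑ c, M x y z a b c * P x y z a b c

/-- The value `ω_S(M) = sup_{P ∈ S} |⟨M, P⟩|`. -/
def bellValue {X A : Type*} [Fintype X] [Fintype A] (S : Set (Table₃ X A)) (M : Table₃ X A) : ℝ :=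
  sSup ((fun P => |pairing M P|) '' S)

/-- A tripartite game: non-negative coefficients whose maxima over the outputs, summed over the
inputs, give at most one. -/
def IsGame {X A : Type*} [Fintype X] (G : Table₃ X A) : Prop :=
  (∀ x y z a b c, 0 ≤ G x y z a b c) ∧
    ∑ x, ∑ y, ∑ z, (⨆ o : A × A × A, G x y z o.1 o.2.1 o.2.2) ≤ 1

/-! ### General bilocal behaviours -/

/-- Conditional probability distributions: `P i o` is the probability of output `o` on input `i`. -/
def IsCondProb {I O : Type*} [Fintype O] (P : I → O → ℝ) : Prop :=
  (∀ i o, 0 ≤ P i o) ∧ ∀ i, ∑ o, P i o = 1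

/-- General (Svetlichny) bilocal behaviours: convex mixtures of behaviours in which one player
answers independently of the other two, who use an arbitrary (possibly signalling) joint
conditional distribution.  The index `j : Fin 3` tells which player is alone, and `s : Fin m` is
the local variable. -/
def generalBilocal (X A : Type*) [Fintype A] : Set (Table₃ X A) :=
  {P | ∃ (m : ℕ) (p : Fin 3 → Fin m → ℝ) (Q : Fin 3 → Fin m → X → A → ℝ)
      (R : Fin 3 → Fin m → X × X → A × A → ℝ),
    (∀ j s, 0 ≤ p j s) ∧ ∑ j, ∑ s, p j s = 1 ∧
    (∀ j s, IsCondProb (Q j s)) ∧ (∀ j s, IsCondProb (R j s)) ∧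
    ∀ x y z a b c, P x y z a b c =
      ∑ s, p 0 s * Q 0 s x a * R 0 s (y, z) (b, c) +
      ∑ s, p 1 s * Q 1 s y b * R 1 s (x, z) (a, c) +
      ∑ s, p 2 s * Q 2 s z c * R 2 s (x, y) (a, b)}

/-! ### Quantum behaviours -/

/-- A family of measurements (POVMs) on `ℂ^d`, with inputs in `X` and outputs in `A`. -/
def IsPOVM {X A : Type*} [Fintype A] {d : ℕ} (E : X → A → Matrix (Fin d) (Fin d) ℂ) : Prop :=
  (∀ x a, (E x a).PosSemidef) ∧ ∀ x, ∑ a, E x a = 1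

/-- Behaviours `⟨ψ| E_{a,x} ⊗ F_{b,y} ⊗ H_{c,z} |ψ⟩`, where `ψ` is a unit vector of
`ℂ^{d₁} ⊗ ℂ^{d₂} ⊗ ℂ^{d₃}` and `E`, `F`, `H` are families of measurements. -/
def quantumOfDim (X A : Type*) [Fintype A] (d₁ d₂ d₃ : ℕ) : Set (Table₃ X A) :=
  {P | ∃ (ψ : Fin d₁ × Fin d₂ × Fin d₃ → ℂ)
      (E : X → A → Matrix (Fin d₁) (Fin d₁) ℂ)
      (F : X → A → Matrix (Fin d₂) (Fin d₂) ℂ)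
      (H : X → A → Matrix (Fin d₃) (Fin d₃) ℂ),
    star ψ ⬝ᵥ ψ = 1 ∧ IsPOVM E ∧ IsPOVM F ∧ IsPOVM H ∧
    ∀ x y z a b c,
      (P x y z a b c : ℂ) = star ψ ⬝ᵥ ((E x a ⊗ₖ (F y b ⊗ₖ H z c)) *ᵥ ψ)}

/-- Quantum behaviours, with arbitrary local dimensions. -/
def quantum (X A : Type*) [Fintype A] : Set (Table₃ X A) :=
  {P | ∃ d₁ d₂ d₃ : ℕ, P ∈ quantumOfDim X A d₁ d₂ d₃}

/-- Quantum behaviours in which at least one of the players is restricted to local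
dimension `d`. -/
def quantumOneDim (X A : Type*) [Fintype A] (d : ℕ) : Set (Table₃ X A) :=
  {P | ∃ d₁ d₂ d₃ : ℕ, (d₁ ≤ d ∨ d₂ ≤ d ∨ d₃ ≤ d) ∧ P ∈ quantumOfDim X A d₁ d₂ d₃}

/-! ### Three instances of a bipartite game, one for each pair of players -/

/-- The tripartite game in which Alice and Bob, Alice and Charlie, and Bob and Charlie each play
one instance of `G`:
`G_{x₁y₁}^{a₁b₁} G_{x₂z₁}^{a₂c₁} G_{y₂z₂}^{b₂c₂}`. -/
def threePair {X A : Type*} (G : Table₂ X A) : Table₃ (X × X) (A × A) :=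
  fun x y z a b c => G x.1 y.1 a.1 b.1 * G x.2 z.1 a.2 c.1 * G y.2 z.2 b.2 c.2

/-! ### The Khot–Vishnoi game -/

/-- `{0,1}^n` for `n = 2^l`; the `n` coordinates are indexed by `{0,1}^l`. -/
abbrev Cube (l : ℕ) : Type := (Fin l → ZMod 2) → ZMod 2

/-- The Hadamard codeword of `s ∈ {0,1}^l`: its coordinate at `t` is `s · t`. -/
def hadamardWord (l : ℕ) : (Fin l → ZMod 2) →+ Cube l where
  toFun s t := ∑ i, s i * t i
  map_zero' := by ext t; simp
  map_add' s s' := by ext t; simp [add_mul, Finset.sum_add_distrib]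

/-- The Hadamard subgroup of `{0,1}^n`. -/
def hadamardSubgroup (l : ℕ) : AddSubgroup (Cube l) := (hadamardWord l).range

/-- The questions of the game: the cosets of the Hadamard subgroup. -/
abbrev KVQuestion (l : ℕ) : Type := Cube l ⧸ hadamardSubgroup l

instance instFintypeKVQuestion (l : ℕ) : Fintype (KVQuestion l) := Fintype.ofFinite _

/-- Labels for the answers; there are `2^l = n` of them. -/
abbrev KVAnswer (l : ℕ) : Type := Fin l → ZMod 2

/-- The element of the coset `q` that has the label `s`: a chosen representative of `q` plus the
Hadamard codeword of `s`. -/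
def cosetElem {l : ℕ} (q : KVQuestion l) (s : KVAnswer l) : Cube l :=
  Quotient.out q + hadamardWord l s

/-- The probability of `z ∈ {0,1}^n` when its coordinates are independent and equal to one with
probability `η`. -/
def noiseProb {l : ℕ} (η : ℝ) (z : Cube l) : ℝ :=
  ∏ t, if z t = 1 then η else 1 - η

open Classical in
/-- The Khot–Vishnoi game: a uniformly random coset `[u]` and a noise vector `z` are drawn, the
questions are `[u]` and `[u + z]`, and the players win if and only if the elements of their cosets
that they answer differ by `z`.  The coefficient at `(x, y, a, b)` is the probability that `x`, `y`
are asked and that `a`, `b` is a winning pair of answers. -/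
def kvGame (l : ℕ) (η : ℝ) : Table₂ (KVQuestion l) (KVAnswer l) :=
  fun x y a b => ∑ u : KVQuestion l, ∑ z : Cube l,
    if x = u ∧ y = u + QuotientAddGroup.mk z ∧ cosetElem x a + cosetElem y b = z then
      1 / (Fintype.card (KVQuestion l) : ℝ) * noiseProb η z
    else 0

/-- The noise rate `η = 1/2 - 1/log n` with `n = 2^l` and the logarithm to base `β`. -/
def kvNoise (β : ℝ) (l : ℕ) : ℝ := 1 / 2 - 1 / Real.logb β ((2 : ℝ) ^ l)

/-- The tripartite game built from the Khot–Vishnoi game with `n = 2^l` and noise rate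
`η = 1/2 - 1/log n`. -/
def kvTripartite (β : ℝ) (l : ℕ) :
    Table₃ (KVQuestion l × KVQuestion l) (KVAnswer l × KVAnswer l) :=
  threePair (kvGame l (kvNoise β l))

end

noncomputable section

/-! ### Bell values -/

section BellValue
variable {X A : Type*} [Fintype X] [Fintype A]

/-! Both upper bounds are entrywise: games are non-negative, so it suffices to dominate a quantum
behaviour by a multiple of a bilocal one. Expand `ψ` along a basis of one player's `ℂ^d`. By
Cauchy–Schwarz, a positive form of a sum of `d` vectors is at most `d` times the sum of its values,
and the value on each slice is a diagonal entry of that player's operator times a form of the other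
two players (`quantumOfDim_le_dim_mul`). For the outputs, `P` is at most its marginal on two
players, which is `K` times the same marginal with a third player guessing uniformly
(`quantumOfDim_le_card_mul`).

For the violation, suppose one player is alone. The other two act as a single opponent, and the lone
player plays two instances of the game against it; the instance inside the cooperating pair can be
granted for free. So the bilocal value is at most the classical value of two parallel Khot–Vishnoi
games (`PairValueLE.abs_pairing_threePair_le`). A strategy is a function on two copies of the cube,
with values in `[0,1]` and one unit of mass per question. Winning is measured by the noise kernel,
so the Bonami–Beckner inequality with exponent `p = 2(1 - η)`, tensorised over all bits and both
copies, gives `n^(2 - 4/p)` (`pairValueLE_kvGame`). With `1/2 - η = 1/log_β n` this is at most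
`β^8/n²`.

Quantum players share a maximally entangled state of dimension `n` per pair and measure in the sign
bases given by the cosets. One instance is then worth the second moment of the mean sign of the
noise, at least `(1 - 2η)² = (2/log_β n)²` (`le_value_entangledProb`), and the three instances
multiply. -/

lemma bellValue_nonneg (S : Set (Table₃ X A)) (M : Table₃ X A) : 0 ≤ bellValue S M := by
  refine Real.sSup_nonneg ?_
  rintro _ ⟨P, -, rfl⟩
  exact abs_nonneg _

lemma bellValue_le {S : Set (Table₃ X A)} {M : Table₃ X A} {c : ℝ} (hc : 0 ≤ c)
    (h : ∀ P ∈ S, |pairing M P| ≤ c) : bellValue S M ≤ c := by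
  refine Real.sSup_le ?_ hc
  rintro _ ⟨P, hP, rfl⟩
  exact h P hP

/-- Some bound `c` has to be supplied: the real `sSup` of an unbounded set is `0`. -/
lemma abs_pairing_le_bellValue {S : Set (Table₃ X A)} {M P : Table₃ X A} {c : ℝ}
    (h : ∀ P ∈ S, |pairing M P| ≤ c) (hP : P ∈ S) : |pairing M P| ≤ bellValue S M := by
  refine le_csSup ⟨c, ?_⟩ ⟨P, hP, rfl⟩
  rintro _ ⟨P, hP, rfl⟩
  exact h P hP

lemma pairing_nonneg {M P : Table₃ X A} (hM : ∀ x y z a b c, 0 ≤ M x y z a b c)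
    (hP : ∀ x y z a b c, 0 ≤ P x y z a b c) : 0 ≤ pairing M P :=
  Finset.sum_nonneg fun _ _ => Finset.sum_nonneg fun _ _ => Finset.sum_nonneg fun _ _ =>
    Finset.sum_nonneg fun _ _ => Finset.sum_nonneg fun _ _ => Finset.sum_nonneg fun _ _ =>
      mul_nonneg (hM _ _ _ _ _ _) (hP _ _ _ _ _ _)

lemma pairing_mono {M P P' : Table₃ X A} (hM : ∀ x y z a b c, 0 ≤ M x y z a b c)
    (hP : ∀ x y z a b c, P x y z a b c ≤ P' x y z a b c) : pairing M P ≤ pairing M P' := by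
  unfold pairing
  gcongr with x _ y _ z _ a _ b _ c _
  exacts [hM _ _ _ _ _ _, hP _ _ _ _ _ _]

lemma pairing_const_mul (M P : Table₃ X A) (k : ℝ) :
    pairing M (fun x y z a b c => k * P x y z a b c) = k * pairing M P := by
  simp only [pairing, Finset.mul_sum]
  refine Finset.sum_congr rfl fun x _ => Finset.sum_congr rfl fun y _ => Finset.sum_congr rfl
    fun z _ => Finset.sum_congr rfl fun a _ => Finset.sum_congr rfl fun b _ =>
    Finset.sum_congr rfl fun c _ => by ring

lemma IsCondProb.le_one {I O : Type*} [Fintype O] {P : I → O → ℝ} (h : IsCondProb P) (i : I)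
    (o : O) : P i o ≤ 1 := by
  rw [← h.2 i]
  exact Finset.single_le_sum (fun o _ => h.1 i o) (Finset.mem_univ o)

lemma isCondProb_uniform (I O : Type*) [Fintype O] [Nonempty O] :
    IsCondProb (fun (_ : I) (_ : O) => (Fintype.card O : ℝ)⁻¹) := by
  refine ⟨fun _ _ => by positivity, fun _ => ?_⟩
  simp

omit [Fintype X] in
lemma generalBilocal_nonneg {P : Table₃ X A} (hP : P ∈ generalBilocal X A) (x y z : X)
    (a b c : A) : 0 ≤ P x y z a b c := by
  obtain ⟨m, p, Q, R, hp, -, hQ, hR, h⟩ := hP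
  rw [h]
  refine add_nonneg (add_nonneg ?_ ?_) ?_ <;>
  exact Finset.sum_nonneg fun s _ => mul_nonneg (mul_nonneg (hp _ _) ((hQ _ _).1 _ _))
    ((hR _ _).1 _ _)

omit [Fintype X] in
lemma generalBilocal_le_one {P : Table₃ X A} (hP : P ∈ generalBilocal X A) (x y z : X)
    (a b c : A) : P x y z a b c ≤ 1 := by
  obtain ⟨m, p, Q, R, hp, hp1, hQ, hR, h⟩ := hP
  rw [h, ← hp1, Fin.sum_univ_three]
  have key : ∀ j s x o y z, p j s * Q j s x o * R j s y z ≤ p j s := fun j s x o y z =>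
    (mul_le_of_le_one_right (mul_nonneg (hp _ _) ((hQ _ _).1 _ _)) ((hR _ _).le_one _ _)).trans
      (mul_le_of_le_one_right (hp _ _) ((hQ _ _).le_one _ _))
  refine add_le_add (add_le_add ?_ ?_) ?_ <;> exact Finset.sum_le_sum fun s _ => key _ _ _ _ _ _

lemma abs_pairing_le_bellValue_generalBilocal (M : Table₃ X A) {P : Table₃ X A}
    (hP : P ∈ generalBilocal X A) : |pairing M P| ≤ bellValue (generalBilocal X A) M := by
  refine abs_pairing_le_bellValue
    -- All entries of `P` lie in `[0,1]`, so the `ℓ₁` norm of `M` bounds every value.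
    (c := ∑ x, ∑ y, ∑ z, ∑ a, ∑ b, ∑ c, |M x y z a b c|) (fun P hP => ?_) hP
  unfold pairing
  iterate 6 refine (Finset.abs_sum_le_sum_abs _ _).trans (Finset.sum_le_sum fun _ _ => ?_)
  rw [abs_mul, abs_of_nonneg (generalBilocal_nonneg hP _ _ _ _ _ _)]
  exact mul_le_of_le_one_right (abs_nonneg _) (generalBilocal_le_one hP _ _ _ _ _ _)

omit [Fintype X] in
/-- Mixtures of bilocal behaviours in which always the same player `k` is alone. -/
lemma mixture_mem_generalBilocal {m : ℕ} {w : Fin m → ℝ} {Q : Fin m → X → A → ℝ}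
    {R : Fin m → X × X → A × A → ℝ} (hw : ∀ s, 0 ≤ w s) (hw1 : ∑ s, w s = 1)
    (hQ : ∀ s, IsCondProb (Q s)) (hR : ∀ s, IsCondProb (R s)) :
    (fun x y z a b c => ∑ s, w s * Q s x a * R s (y, z) (b, c)) ∈ generalBilocal X A ∧
    (fun x y z a b c => ∑ s, w s * Q s y b * R s (x, z) (a, c)) ∈ generalBilocal X A ∧
    (fun x y z a b c => ∑ s, w s * Q s z c * R s (x, y) (a, b)) ∈ generalBilocal X A := by
  have aux : ∀ k : Fin 3, (∀ j s, 0 ≤ if j = k then w s else 0) ∧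
      ∑ j, ∑ s, (if j = k then w s else 0) = 1 := by
    intro k
    constructor
    · intro j s
      split_ifs
      exacts [hw s, le_rfl]
    · rw [Finset.sum_comm]
      simpa using hw1
  refine ⟨⟨m, fun j s => if j = 0 then w s else 0, fun _ => Q, fun _ => R, (aux 0).1, (aux 0).2,
    fun _ => hQ, fun _ => hR, ?_⟩, ⟨m, fun j s => if j = 1 then w s else 0, fun _ => Q,
    fun _ => R, (aux 1).1, (aux 1).2, fun _ => hQ, fun _ => hR, ?_⟩,
    ⟨m, fun j s => if j = 2 then w s else 0, fun _ => Q,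
    fun _ => R, (aux 2).1, (aux 2).2, fun _ => hQ, fun _ => hR, ?_⟩⟩ <;>
  · intro x y z a b c
    simp

/-- If a behaviour is dominated by a multiple of a bilocal one, then so is its value on
nonnegative functionals. -/
lemma abs_pairing_le_of_le_mul {G P P' : Table₃ X A} {k k' : ℝ}
    (hG : ∀ x y z a b c, 0 ≤ G x y z a b c) (hP : ∀ x y z a b c, 0 ≤ P x y z a b c)
    (hk : 0 ≤ k) (hkk' : k ≤ k') (hP' : P' ∈ generalBilocal X A)
    (h : ∀ x y z a b c, P x y z a b c ≤ k * P' x y z a b c) :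
    |pairing G P| ≤ k' * bellValue (generalBilocal X A) G := by
  rw [abs_of_nonneg (pairing_nonneg hG hP)]
  calc pairing G P ≤ pairing G (fun x y z a b c => k * P' x y z a b c) := pairing_mono hG h
    _ = k * pairing G P' := pairing_const_mul _ _ _
    _ ≤ k * bellValue (generalBilocal X A) G := by
        gcongr
        exact (le_abs_self _).trans (abs_pairing_le_bellValue_generalBilocal G hP')
    _ ≤ _ := by gcongr; exact bellValue_nonneg _ _

end BellValue

/-! ### Quantum behaviours are dominated by bilocal ones -/

section Quadratic

/-- The quadratic form of a matrix. -/
def quadForm {κ : Type*} [Fintype κ] (T : Matrix κ κ ℂ) (v : κ → ℂ) : ℝ :=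
  (star v ⬝ᵥ (T *ᵥ v)).re

variable {κ : Type*} [Fintype κ]

lemma quadForm_nonneg {T : Matrix κ κ ℂ} (hT : T.PosSemidef) (v : κ → ℂ) : 0 ≤ quadForm T v :=
  (Complex.nonneg_iff.1 (hT.dotProduct_mulVec_nonneg v)).1

lemma quadForm_sum {O : Type*} (s : Finset O) (T : O → Matrix κ κ ℂ) (v : κ → ℂ) :
    ∑ o ∈ s, quadForm (T o) v = quadForm (∑ o ∈ s, T o) v := by
  simp only [quadForm, Matrix.sum_mulVec, dotProduct_sum, Complex.re_sum]

lemma quadForm_one [DecidableEq κ] (v : κ → ℂ) : quadForm 1 v = ∑ k, Complex.normSq (v k) := by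
  simp [quadForm, dotProduct, Complex.normSq_apply]

open scoped MatrixOrder Matrix.Norms.L2Operator in
-- Writing `T = Bᴴ B` turns the form into a sum of squares `|(B v)_k|²`; Cauchy–Schwarz on `d`
-- summands loses the factor `d` in each.
lemma quadForm_sum_le [DecidableEq κ] {d : ℕ} {T : Matrix κ κ ℂ} (hT : T.PosSemidef)
    (v : Fin d → κ → ℂ) : quadForm T (∑ i, v i) ≤ d * ∑ i, quadForm T (v i) := by
  obtain ⟨B, rfl⟩ : ∃ B : Matrix κ κ ℂ, T = Bᴴ * B :=
    CStarAlgebra.nonneg_iff_eq_star_mul_self.1 hT.nonneg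
  have hq : ∀ u : κ → ℂ, quadForm (Bᴴ * B) u = ∑ k, ‖(B *ᵥ u) k‖ ^ 2 := by
    intro u
    rw [quadForm, ← Matrix.mulVec_mulVec, Matrix.dotProduct_mulVec, ← Matrix.star_mulVec]
    simp [dotProduct, ← Complex.normSq_eq_norm_sq, Complex.normSq_apply]
  simp only [hq, Matrix.mulVec_sum, Finset.sum_apply]
  rw [Finset.sum_comm, Finset.mul_sum]
  refine Finset.sum_le_sum fun k _ => ?_
  calc ‖∑ i, (B *ᵥ v i) k‖ ^ 2 ≤ (∑ i, ‖(B *ᵥ v i) k‖) ^ 2 := by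
        gcongr; exact norm_sum_le _ _
    _ ≤ _ := by
        simpa using sq_sum_le_card_mul_sum_sq (s := Finset.univ) (f := fun i => ‖(B *ᵥ v i) k‖)

/-- Cutting a vector into its `d` slices along one tensor factor costs at most a factor `d`. -/
lemma quadForm_le_sum_slices [DecidableEq κ] {μ : Type*} [Fintype μ] {d : ℕ} (e : κ ≃ Fin d × μ)
    {T : Matrix κ κ ℂ} (hT : T.PosSemidef) {E : Matrix (Fin d) (Fin d) ℂ} (hE : E.PosSemidef)
    {S : Matrix μ μ ℂ} (h : ∀ p q, T p q = E (e p).1 (e q).1 * S (e p).2 (e q).2) (ψ : κ → ℂ) :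
    quadForm T ψ ≤ d * ∑ i, (E i i).re * quadForm S (fun m => ψ (e.symm (i, m))) := by
  classical
  have hψ : ψ = ∑ i, fun p => if (e p).1 = i then ψ p else 0 := by
    ext p
    simp [Finset.sum_apply]
  conv_lhs => rw [hψ]
  refine (quadForm_sum_le hT _).trans (le_of_eq ?_)
  congr 1
  refine Finset.sum_congr rfl fun i _ => ?_
  -- Diagonal entries of a positive matrix are real, so this one can be pulled out of the real part.
  have him : (E i i).im = 0 := (Complex.nonneg_iff.1 (hE.diag_nonneg (i := i))).2.symm
  rw [quadForm, quadForm, ← Complex.re_add_im (E i i), him]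
  simp only [Complex.ofReal_zero, zero_mul, add_zero, Complex.ofReal_re]
  rw [← Complex.re_ofReal_mul]
  congr 1
  have hEi : ((E i i).re : ℂ) = E i i := by
    conv_rhs => rw [← Complex.re_add_im (E i i), him]
    simp
  rw [hEi]
  simp only [dotProduct, Matrix.mulVec, h]
  rw [← e.symm.sum_comp]
  simp only [← e.symm.sum_comp (fun q => _ * _), Fintype.sum_prod_type, Pi.star_apply,
    Equiv.apply_symm_apply]
  rw [Finset.sum_eq_single i]
  · rw [Finset.mul_sum]
    refine Finset.sum_congr rfl fun m _ => ?_
    rw [Finset.sum_eq_single i]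
    · simp only [if_true, Finset.mul_sum]
      refine Finset.sum_congr rfl fun m' _ => by ring
    · intro j _ hj
      simp [hj]
    · simp
  · intro j _ hj
    simp [hj]
  · simp

end Quadratic

section Quantum
variable {X A : Type*} [Fintype A]

lemma sum_kronecker_of_isPOVM {d₁ d₂ : ℕ} {F : X → A → Matrix (Fin d₁) (Fin d₁) ℂ}
    {H : X → A → Matrix (Fin d₂) (Fin d₂) ℂ} (hF : IsPOVM F) (hH : IsPOVM H) (y z : X) :
    ∑ o : A × A, F y o.1 ⊗ₖ H z o.2 = 1 := by
  rw [← Matrix.one_kronecker_one, ← hF.2 y, ← hH.2 z]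
  ext i j
  simp only [Matrix.sum_apply, Matrix.kroneckerMap_apply, Finset.sum_mul_sum, Fintype.sum_prod_type]

/-- The slices of a quantum state give a mixture of product strategies. -/
lemma exists_mixture_of_slices [Nonempty A] {κ : Type*} [Fintype κ] {d d₁ d₂ : ℕ}
    (e : κ ≃ Fin d × (Fin d₁ × Fin d₂)) {ψ : κ → ℂ} (hψ : star ψ ⬝ᵥ ψ = 1)
    {E : X → A → Matrix (Fin d) (Fin d) ℂ} {F : X → A → Matrix (Fin d₁) (Fin d₁) ℂ}
    {H : X → A → Matrix (Fin d₂) (Fin d₂) ℂ} (hE : IsPOVM E) (hF : IsPOVM F) (hH : IsPOVM H) :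
    ∃ (w : Fin d → ℝ) (Q : Fin d → X → A → ℝ) (R : Fin d → X × X → A × A → ℝ),
      (∀ s, 0 ≤ w s) ∧ ∑ s, w s = 1 ∧ (∀ s, IsCondProb (Q s)) ∧ (∀ s, IsCondProb (R s)) ∧
      ∀ s x y z a b c, w s * Q s x a * R s (y, z) (b, c) =
        (E x a s s).re * quadForm (F y b ⊗ₖ H z c) (fun m => ψ (e.symm (s, m))) := by
  classical
  set φ : Fin d → Fin d₁ × Fin d₂ → ℂ := fun s m => ψ (e.symm (s, m)) with hφ
  have hq0 : ∀ s y z b c, 0 ≤ quadForm (F y b ⊗ₖ H z c) (φ s) := fun s y z b c =>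
    quadForm_nonneg ((hF.1 y b).kronecker (hH.1 z c)) _
  have hq1 : ∀ s y z, ∑ o : A × A, quadForm (F y o.1 ⊗ₖ H z o.2) (φ s) = quadForm 1 (φ s) := by
    intro s y z
    rw [quadForm_sum, sum_kronecker_of_isPOVM hF hH]
  have hw0 : ∀ s, 0 ≤ quadForm 1 (φ s) := fun s => quadForm_nonneg Matrix.PosSemidef.one _
  refine ⟨fun s => quadForm 1 (φ s), fun s x a => (E x a s s).re,
    -- The weight of a slice is its squared norm, and `R` is the conditional distribution given the
    -- slice. A slice of weight zero needs some distribution; the uniform one is taken.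
    fun s yz bc => if quadForm 1 (φ s) = 0 then (Fintype.card (A × A) : ℝ)⁻¹ else
      quadForm (F yz.1 bc.1 ⊗ₖ H yz.2 bc.2) (φ s) / quadForm 1 (φ s),
    hw0, ?_, ?_, ?_, ?_⟩
  · have : (star ψ ⬝ᵥ ψ).re = 1 := by rw [hψ]; rfl
    rw [← Matrix.one_mulVec ψ] at this
    have h2 : quadForm 1 ψ = 1 := by
      rw [quadForm]; convert this using 3; simp
    rw [← h2, quadForm_one, ← e.symm.sum_comp, Fintype.sum_prod_type]
    simp only [quadForm_one, hφ]
  · intro s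
    refine ⟨fun x a => (Complex.nonneg_iff.1 ((hE.1 x a).diag_nonneg (i := s))).1, fun x => ?_⟩
    rw [← Complex.re_sum, ← Matrix.sum_apply, hE.2 x]
    simp
  · intro s
    by_cases h0 : quadForm 1 (φ s) = 0
    · simp only [h0, if_true]
      exact isCondProb_uniform _ _
    · simp only [h0, if_false]
      refine ⟨fun yz bc => div_nonneg (hq0 _ _ _ _ _) (hw0 _), fun yz => ?_⟩
      rw [← Finset.sum_div, hq1, div_self h0]
  · intro s x y z a b c
    have h2 : quadForm 1 (φ s) = 0 → quadForm (F y b ⊗ₖ H z c) (φ s) = 0 := fun h0 =>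
      (Finset.sum_eq_zero_iff_of_nonneg fun o _ => hq0 s y z o.1 o.2).1
        ((hq1 s y z).trans h0) (b, c) (Finset.mem_univ _)
    dsimp only
    split_ifs with h0
    · rw [h2 h0, h0]
      simp
    · rw [mul_right_comm, mul_div_cancel₀ _ h0, mul_comm]

omit [Fintype A] in
lemma quantumOfDim_eq_quadForm {d₁ d₂ d₃ : ℕ} {P : Table₃ X A}
    {ψ : Fin d₁ × Fin d₂ × Fin d₃ → ℂ} {E : X → A → Matrix (Fin d₁) (Fin d₁) ℂ}
    {F : X → A → Matrix (Fin d₂) (Fin d₂) ℂ} {H : X → A → Matrix (Fin d₃) (Fin d₃) ℂ}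
    {x y z : X} {a b c : A}
    (h : (P x y z a b c : ℂ) = star ψ ⬝ᵥ ((E x a ⊗ₖ (F y b ⊗ₖ H z c)) *ᵥ ψ)) :
    P x y z a b c = quadForm (E x a ⊗ₖ (F y b ⊗ₖ H z c)) ψ := by
  rw [quadForm, ← h, Complex.ofReal_re]

lemma quantumOfDim_nonneg {d₁ d₂ d₃ : ℕ} {P : Table₃ X A} (hP : P ∈ quantumOfDim X A d₁ d₂ d₃)
    (x y z : X) (a b c : A) : 0 ≤ P x y z a b c := by
  obtain ⟨ψ, E, F, H, -, hE, hF, hH, h⟩ := hP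
  rw [quantumOfDim_eq_quadForm (h x y z a b c)]
  exact quadForm_nonneg ((hE.1 x a).kronecker ((hF.1 y b).kronecker (hH.1 z c))) _

/-- A quantum behaviour is dominated by a bilocal one, up to the dimension of any one player. -/
lemma quantumOfDim_le_dim_mul [Nonempty A] {d₁ d₂ d₃ : ℕ} {P : Table₃ X A}
    (hP : P ∈ quantumOfDim X A d₁ d₂ d₃) :
    (∃ P' ∈ generalBilocal X A, ∀ x y z a b c, P x y z a b c ≤ d₁ * P' x y z a b c) ∧
    (∃ P' ∈ generalBilocal X A, ∀ x y z a b c, P x y z a b c ≤ d₂ * P' x y z a b c) ∧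
    (∃ P' ∈ generalBilocal X A, ∀ x y z a b c, P x y z a b c ≤ d₃ * P' x y z a b c) := by
  obtain ⟨ψ, E, F, H, hψ, hE, hF, hH, h⟩ := hP
  have hT : ∀ x y z a b c, (E x a ⊗ₖ (F y b ⊗ₖ H z c)).PosSemidef := fun x y z a b c =>
    (hE.1 x a).kronecker ((hF.1 y b).kronecker (hH.1 z c))
  let e₁ := Equiv.refl (Fin d₁ × Fin d₂ × Fin d₃)
  -- `e₂` and `e₃` bring the second and third tensor factors to the front, so that slicing applies
  -- to each player.
  let e₂ : Fin d₁ × Fin d₂ × Fin d₃ ≃ Fin d₂ × Fin d₁ × Fin d₃ :=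
    ⟨fun p => (p.2.1, p.1, p.2.2), fun p => (p.2.1, p.1, p.2.2), fun _ => rfl, fun _ => rfl⟩
  let e₃ : Fin d₁ × Fin d₂ × Fin d₃ ≃ Fin d₃ × Fin d₁ × Fin d₂ :=
    ⟨fun p => (p.2.2, p.1, p.2.1), fun p => (p.2.1, p.2.2, p.1), fun _ => rfl, fun _ => rfl⟩
  refine ⟨?_, ?_, ?_⟩
  · obtain ⟨w, Q, R, hw, hw1, hQ, hR, hwQR⟩ := exists_mixture_of_slices e₁ hψ hE hF hH
    refine ⟨_, (mixture_mem_generalBilocal hw hw1 hQ hR).1, fun x y z a b c => ?_⟩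
    simp only [hwQR]
    rw [quantumOfDim_eq_quadForm (h x y z a b c)]
    exact quadForm_le_sum_slices e₁ (hT _ _ _ _ _ _) (hE.1 x a) (fun p q => rfl) ψ
  · obtain ⟨w, Q, R, hw, hw1, hQ, hR, hwQR⟩ := exists_mixture_of_slices e₂ hψ hF hE hH
    refine ⟨_, (mixture_mem_generalBilocal hw hw1 hQ hR).2.1, fun x y z a b c => ?_⟩
    simp only [hwQR]
    rw [quantumOfDim_eq_quadForm (h x y z a b c)]
    refine quadForm_le_sum_slices e₂ (hT _ _ _ _ _ _) (hF.1 y b) (fun p q => ?_) ψ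
    simp only [Matrix.kroneckerMap_apply, e₂, Equiv.coe_fn_mk]
    ring
  · obtain ⟨w, Q, R, hw, hw1, hQ, hR, hwQR⟩ := exists_mixture_of_slices e₃ hψ hH hE hF
    refine ⟨_, (mixture_mem_generalBilocal hw hw1 hQ hR).2.2, fun x y z a b c => ?_⟩
    simp only [hwQR]
    rw [quantumOfDim_eq_quadForm (h x y z a b c)]
    refine quadForm_le_sum_slices e₃ (hT _ _ _ _ _ _) (hH.1 z c) (fun p q => ?_) ψ
    simp only [Matrix.kroneckerMap_apply, e₃, Equiv.coe_fn_mk]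
    ring

/-- A quantum behaviour is dominated by its marginal, and the latter is bilocal after adding a
player who answers uniformly at random. -/
lemma quantumOfDim_le_card_mul [Nonempty A] {d₁ d₂ d₃ : ℕ} {P : Table₃ X A}
    (hP : P ∈ quantumOfDim X A d₁ d₂ d₃) :
    ∃ P' ∈ generalBilocal X A, ∀ x y z a b c,
      P x y z a b c ≤ Fintype.card A * P' x y z a b c := by
  classical
  obtain ⟨ψ, E, F, H, hψ, hE, hF, hH, h⟩ := hP
  have hR : IsCondProb (fun (yz : X × X) (bc : A × A) =>
      quadForm ((1 : Matrix (Fin d₁) (Fin d₁) ℂ) ⊗ₖ (F yz.1 bc.1 ⊗ₖ H yz.2 bc.2)) ψ) := by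
    refine ⟨fun yz bc => quadForm_nonneg (Matrix.PosSemidef.one.kronecker
      ((hF.1 _ _).kronecker (hH.1 _ _))) _, fun yz => ?_⟩
    rw [quadForm_sum]
    have : ∑ o : A × A, (1 : Matrix (Fin d₁) (Fin d₁) ℂ) ⊗ₖ (F yz.1 o.1 ⊗ₖ H yz.2 o.2) = 1 := by
      rw [← Matrix.one_kronecker_one, ← sum_kronecker_of_isPOVM hF hH yz.1 yz.2]
      ext i j
      simp only [Matrix.sum_apply, Matrix.kroneckerMap_apply, Finset.mul_sum]
    rw [this, quadForm, Matrix.one_mulVec, hψ, Complex.one_re]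
  refine ⟨_, (mixture_mem_generalBilocal (m := 1) (w := fun _ => 1) (fun _ => zero_le_one)
    (by simp) (fun _ => isCondProb_uniform X A) (fun _ => hR)).1, fun x y z a b c => ?_⟩
  simp only [Finset.univ_unique, Finset.sum_singleton, one_mul]
  -- The factor `|A|` cancels the uniform guess; what is left is one term of the marginal against
  -- the whole sum over `a`.
  rw [mul_inv_cancel_left₀ (by positivity), quantumOfDim_eq_quadForm (h x y z a b c)]
  have : (1 : Matrix (Fin d₁) (Fin d₁) ℂ) ⊗ₖ (F y b ⊗ₖ H z c) =
      ∑ a, E x a ⊗ₖ (F y b ⊗ₖ H z c) := by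
    rw [← hE.2 x]
    ext i j
    simp only [Matrix.sum_apply, Matrix.kroneckerMap_apply, Finset.sum_mul]
  rw [this, ← quadForm_sum]
  exact Finset.single_le_sum (f := fun a => quadForm (E x a ⊗ₖ (F y b ⊗ₖ H z c)) ψ)
    (fun a _ => quadForm_nonneg ((hE.1 x a).kronecker ((hF.1 y b).kronecker (hH.1 z c))) _)
    (Finset.mem_univ a)

variable [Fintype X]

lemma pairing_eq_zero_of_isEmpty [IsEmpty A] (G P : Table₃ X A) : pairing G P = 0 := by
  simp [pairing]

lemma abs_pairing_quantum_le {G P : Table₃ X A} (hG : ∀ x y z a b c, 0 ≤ G x y z a b c)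
    (hP : P ∈ quantum X A) :
    |pairing G P| ≤ Fintype.card A * bellValue (generalBilocal X A) G := by
  rcases isEmpty_or_nonempty A with hA | hA
  · rw [pairing_eq_zero_of_isEmpty, abs_zero]
    exact mul_nonneg (Nat.cast_nonneg _) (bellValue_nonneg _ _)
  obtain ⟨d₁, d₂, d₃, hP⟩ := hP
  obtain ⟨P', hP', h⟩ := quantumOfDim_le_card_mul hP
  exact abs_pairing_le_of_le_mul hG (quantumOfDim_nonneg hP) (Nat.cast_nonneg _) le_rfl hP' h

lemma bellValue_quantum_le {G : Table₃ X A} (hG : ∀ x y z a b c, 0 ≤ G x y z a b c) :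
    bellValue (quantum X A) G ≤ Fintype.card A * bellValue (generalBilocal X A) G :=
  bellValue_le (mul_nonneg (Nat.cast_nonneg _) (bellValue_nonneg _ _))
    fun _ hP => abs_pairing_quantum_le hG hP

lemma bellValue_quantumOneDim_le {G : Table₃ X A} (hG : ∀ x y z a b c, 0 ≤ G x y z a b c)
    (d : ℕ) :
    bellValue (quantumOneDim X A d) G ≤ d * bellValue (generalBilocal X A) G := by
  have hnn : 0 ≤ d * bellValue (generalBilocal X A) G :=
    mul_nonneg (Nat.cast_nonneg _) (bellValue_nonneg _ _)
  refine bellValue_le hnn ?_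
  rintro P ⟨d₁, d₂, d₃, hd, hP⟩
  rcases isEmpty_or_nonempty A with hA | hA
  · rwa [pairing_eq_zero_of_isEmpty, abs_zero]
  have hP0 := quantumOfDim_nonneg hP
  obtain ⟨⟨P₁, h₁, h₁'⟩, ⟨P₂, h₂, h₂'⟩, ⟨P₃, h₃, h₃'⟩⟩ := quantumOfDim_le_dim_mul hP
  rcases hd with hd | hd | hd
  · exact abs_pairing_le_of_le_mul hG hP0 (Nat.cast_nonneg _) (Nat.cast_le.2 hd) h₁ h₁'
  · exact abs_pairing_le_of_le_mul hG hP0 (Nat.cast_nonneg _) (Nat.cast_le.2 hd) h₂ h₂'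
  · exact abs_pairing_le_of_le_mul hG hP0 (Nat.cast_nonneg _) (Nat.cast_le.2 hd) h₃ h₃'

end Quantum

/-! ### Two-function hypercontractivity -/

/-- There is equality at `y = 0`. The derivative of the difference is non-negative by AM–GM, because
`(1+t)^(r-1) (1-t)^(r-1) = (1-t²)^(r-1) ≥ 1`. With `r = p - 1` this is the derivative estimate
behind `two_add_le_rpow_add_rpow`. -/
lemma two_mul_le_rpow_sub_rpow {r y : ℝ} (hr0 : 0 < r) (hr1 : r ≤ 1) (hy0 : 0 ≤ y) (hy1 : y ≤ 1) :
    2 * r * y ≤ (1 + y) ^ r - (1 - y) ^ r := by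
  have hmono : MonotoneOn (fun t : ℝ => (1 + t) ^ r - (1 - t) ^ r - 2 * r * t) (Set.Icc 0 1) := by
    have hd : ∀ t ∈ interior (Set.Icc (0 : ℝ) 1),
        HasDerivAt (fun t : ℝ => (1 + t) ^ r - (1 - t) ^ r - 2 * r * t)
          (1 * r * (1 + t) ^ (r - 1) - (-1) * r * (1 - t) ^ (r - 1) - 2 * r * 1) t := by
      intro t ht
      rw [interior_Icc] at ht
      obtain ⟨h0, h1⟩ := ht
      exact ((((hasDerivAt_id' t).const_add 1).rpow_const (Or.inl (by linarith))).sub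
        (((hasDerivAt_id' t).const_sub 1).rpow_const (Or.inl (by linarith)))).sub
        ((hasDerivAt_id' t).const_mul (2 * r))
    refine monotoneOn_of_deriv_nonneg (convex_Icc 0 1) ?_
      (fun t ht => (hd t ht).differentiableAt.differentiableWithinAt) ?_
    · exact ((((continuous_const.add continuous_id).rpow_const fun _ => Or.inr hr0.le).sub
        ((continuous_const.sub continuous_id).rpow_const fun _ => Or.inr hr0.le)).sub
        (continuous_const.mul continuous_id)).continuousOn
    · intro t ht
      rw [(hd t ht).deriv]
      rw [interior_Icc] at ht
      obtain ⟨h0, h1⟩ := ht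
      have hA : 0 < (1 + t) ^ (r - 1) := Real.rpow_pos_of_pos (by linarith) _
      have hB : 0 < (1 - t) ^ (r - 1) := Real.rpow_pos_of_pos (by linarith) _
      have hAB : 1 ≤ (1 + t) ^ (r - 1) * (1 - t) ^ (r - 1) := by
        rw [← Real.mul_rpow (by linarith) (by linarith)]
        exact Real.one_le_rpow_of_pos_of_le_one_of_nonpos (by nlinarith) (by nlinarith)
          (by linarith)
      have : 2 ≤ (1 + t) ^ (r - 1) + (1 - t) ^ (r - 1) := by
        nlinarith [sq_nonneg ((1 + t) ^ (r - 1) - (1 - t) ^ (r - 1))]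
      nlinarith
  have := hmono (Set.left_mem_Icc.2 zero_le_one) ⟨hy0, hy1⟩ hy0
  simp at this
  linarith

lemma two_add_le_rpow_add_rpow {p y : ℝ} (hp1 : 1 < p) (hp2 : p ≤ 2) (hy0 : 0 ≤ y) (hy1 : y ≤ 1) :
    2 + p * (p - 1) * y ^ 2 ≤ (1 + y) ^ p + (1 - y) ^ p := by
  have hmono : MonotoneOn (fun t : ℝ => (1 + t) ^ p + (1 - t) ^ p - p * (p - 1) * t ^ 2)
      (Set.Icc 0 1) := by
    have hd : ∀ t ∈ interior (Set.Icc (0 : ℝ) 1),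
        HasDerivAt (fun t : ℝ => (1 + t) ^ p + (1 - t) ^ p - p * (p - 1) * t ^ 2)
          (1 * p * (1 + t) ^ (p - 1) + (-1) * p * (1 - t) ^ (p - 1) -
            p * (p - 1) * (2 * t)) t := by
      intro t ht
      have h2 : HasDerivAt (fun t : ℝ => t ^ 2) (2 * t) t := by simpa using hasDerivAt_pow 2 t
      exact ((((hasDerivAt_id' t).const_add 1).rpow_const (Or.inr hp1.le)).add
        (((hasDerivAt_id' t).const_sub 1).rpow_const (Or.inr hp1.le))).sub (h2.const_mul _)
    refine monotoneOn_of_deriv_nonneg (convex_Icc 0 1) ?_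
      (fun t ht => (hd t ht).differentiableAt.differentiableWithinAt) ?_
    · exact ((((continuous_const.add continuous_id).rpow_const fun _ => Or.inr (by linarith)).add
        ((continuous_const.sub continuous_id).rpow_const fun _ => Or.inr (by linarith))).sub
        (continuous_const.mul (continuous_id.pow 2))).continuousOn
    · intro t ht
      rw [(hd t ht).deriv]
      rw [interior_Icc] at ht
      have := two_mul_le_rpow_sub_rpow (r := p - 1) (by linarith) (by linarith) ht.1.le ht.2.le
      nlinarith
  have := hmono (Set.left_mem_Icc.2 zero_le_one) ⟨hy0, hy1⟩ hy0
  simp at this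
  linarith

/-- The two-point inequality of Bonami and Beckner. -/
lemma two_point_inequality {p a b : ℝ} (hp1 : 1 < p) (hp2 : p ≤ 2) (ha : 0 ≤ a) (hb : 0 ≤ b) :
    ((a + b) / 2) ^ 2 + (p - 1) * ((a - b) / 2) ^ 2 ≤ (((a ^ p + b ^ p) / 2) ^ (1 / p)) ^ 2 := by
  wlog hab : b ≤ a generalizing a b
  · have := this hb ha (le_of_not_ge hab)
    rw [add_comm (b ^ p)] at this
    calc _ = ((b + a) / 2) ^ 2 + (p - 1) * ((b - a) / 2) ^ 2 := by ring
      _ ≤ _ := this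
  rcases ha.eq_or_lt with rfl | ha'
  · have : b = 0 := le_antisymm hab hb
    subst this
    simpa using sq_nonneg ((((0 : ℝ) ^ p + 0 ^ p) / 2) ^ (1 / p))
  -- By homogeneity, divide by the mean: the pair becomes `1 + y`, `1 - y` with `0 ≤ y ≤ 1`.
  set m := (a + b) / 2 with hm
  have hm0 : 0 < m := by positivity
  set y := (a - b) / 2 / m with hy
  have hy0 : 0 ≤ y := div_nonneg (by linarith) hm0.le
  have hy1 : y ≤ 1 := by rw [hy, div_le_one hm0]; linarith
  have hmy : m * y = (a - b) / 2 := by rw [hy]; field_simp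
  have ha2 : a = m * (1 + y) := by rw [mul_add, hmy]; ring
  have hb2 : b = m * (1 - y) := by rw [mul_sub, hmy]; ring
  have key := two_add_le_rpow_add_rpow hp1 hp2 hy0 hy1
  -- Bernoulli for the exponent `p/2 ≤ 1` gives the upper bound `1 + (p/2)(p-1)y²`, which is half
  -- the left side of `key`.
  have hbern : (1 + (p - 1) * y ^ 2) ^ (p / 2) ≤ ((1 + y) ^ p + (1 - y) ^ p) / 2 := by
    have := rpow_one_add_le_one_add_mul_self (s := (p - 1) * y ^ 2) (p := p / 2)
      (by nlinarith [sq_nonneg y]) (by linarith) (by linarith)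
    linarith
  have hbase : 0 ≤ 1 + (p - 1) * y ^ 2 := by nlinarith [sq_nonneg y]
  have h1 : (a ^ p + b ^ p) / 2 = m ^ p * (((1 + y) ^ p + (1 - y) ^ p) / 2) := by
    rw [ha2, hb2, Real.mul_rpow hm0.le (by linarith), Real.mul_rpow hm0.le (by linarith)]; ring
  rw [← hmy, h1]
  calc m ^ 2 + (p - 1) * (m * y) ^ 2 = m ^ 2 * (1 + (p - 1) * y ^ 2) := by ring
    _ = ((m ^ p * (1 + (p - 1) * y ^ 2) ^ (p / 2)) ^ (1 / p)) ^ 2 := by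
      rw [Real.mul_rpow (by positivity) (by positivity), ← Real.rpow_mul hm0.le,
        ← Real.rpow_mul hbase, mul_pow, mul_one_div_cancel (by linarith), Real.rpow_one,
        ← Real.rpow_natCast (_ ^ _), ← Real.rpow_mul hbase]
      rw [show p / 2 * (1 / p) * ((2 : ℕ) : ℝ) = 1 by push_cast; field_simp, Real.rpow_one]
    _ ≤ _ := by gcongr

/-- The kernel `K` is bounded, as a bilinear form on nonnegative functions, by `c` times the
product of the `ℓ_p` norms. -/
def HasFormBound {α : Type*} [Fintype α] (K : α → α → ℝ) (p c : ℝ) : Prop :=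
  ∀ f g : α → ℝ, (∀ x, 0 ≤ f x) → (∀ x, 0 ≤ g x) →
    ∑ x, ∑ y, K x y * f x * g y ≤ c * (∑ x, f x ^ p) ^ (1 / p) * (∑ x, g x ^ p) ^ (1 / p)

/-- Apply the first bound to the slices with the second coordinates fixed, then the second bound to
the `ℓ_p` norms of the slices; the `ℓ_p` norm of these norms is the full norm. Non-negativity of
`K'` lets the first estimate pass through the outer sum. -/
lemma HasFormBound.prod {α α' : Type*} [Fintype α] [Fintype α'] {K : α → α → ℝ}
    {K' : α' → α' → ℝ} {p c c' : ℝ} (hp : 0 < p) (hK' : ∀ x y, 0 ≤ K' x y) (hc : 0 ≤ c)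
    (h : HasFormBound K p c) (h' : HasFormBound K' p c') :
    HasFormBound (fun x y : α × α' => K x.1 y.1 * K' x.2 y.2) p (c * c') := by
  intro f g hf hg
  have hpow : ∀ (k : α × α' → ℝ), (∀ x, 0 ≤ k x) → ∀ x',
      ((∑ x, k (x, x') ^ p) ^ (1 / p)) ^ p = ∑ x, k (x, x') ^ p := by
    intro k hk x'
    rw [← Real.rpow_mul (Finset.sum_nonneg fun x _ => Real.rpow_nonneg (hk _) _),
      one_div_mul_cancel hp.ne', Real.rpow_one]
  have hn : ∀ (k : α × α' → ℝ), (∀ x, 0 ≤ k x) → ∀ x', 0 ≤ (∑ x, k (x, x') ^ p) ^ (1 / p) :=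
    fun k hk x' => Real.rpow_nonneg (Finset.sum_nonneg fun x _ => Real.rpow_nonneg (hk _) _) _
  calc ∑ x : α × α', ∑ y : α × α', K x.1 y.1 * K' x.2 y.2 * f x * g y
      = ∑ x', ∑ y', K' x' y' * ∑ x, ∑ y, K x y * f (x, x') * g (y, y') := by
        simp only [Fintype.sum_prod_type_right, Finset.mul_sum]
        refine Finset.sum_congr rfl fun x' _ => ?_
        rw [Finset.sum_comm]
        refine Finset.sum_congr rfl fun y' _ => Finset.sum_congr rfl fun x _ =>
          Finset.sum_congr rfl fun y _ => by ring
    _ ≤ ∑ x', ∑ y', K' x' y' * (c * (∑ x, f (x, x') ^ p) ^ (1 / p) *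
          (∑ y, g (y, y') ^ p) ^ (1 / p)) := by
        gcongr with x' _ y' _
        · exact hK' _ _
        · exact h _ _ (fun _ => hf _) (fun _ => hg _)
    _ = c * ∑ x', ∑ y', K' x' y' * (∑ x, f (x, x') ^ p) ^ (1 / p) *
          (∑ y, g (y, y') ^ p) ^ (1 / p) := by
        simp only [Finset.mul_sum]
        refine Finset.sum_congr rfl fun x' _ => Finset.sum_congr rfl fun y' _ => by ring
    _ ≤ c * (c' * (∑ x', ((∑ x, f (x, x') ^ p) ^ (1 / p)) ^ p) ^ (1 / p) *
          (∑ x', ((∑ x, g (x, x') ^ p) ^ (1 / p)) ^ p) ^ (1 / p)) :=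
        mul_le_mul_of_nonneg_left (h' _ _ (hn f hf) (hn g hg)) hc
    _ = _ := by
        simp only [hpow f hf, hpow g hg, Fintype.sum_prod_type_right, mul_assoc]

lemma HasFormBound.comp_equiv {α β : Type*} [Fintype α] [Fintype β] {K : α → α → ℝ} {p c : ℝ}
    (e : β ≃ α) (h : HasFormBound K p c) : HasFormBound (fun x y => K (e x) (e y)) p c := by
  intro f g hf hg
  have := h (f ∘ e.symm) (g ∘ e.symm) (fun _ => hf _) (fun _ => hg _)
  simpa [← e.sum_comp] using this

lemma hasFormBound_pi_fin {α : Type*} [Fintype α] {K : α → α → ℝ} {p c : ℝ} (hp : 0 < p)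
    (hK : ∀ x y, 0 ≤ K x y) (hc : 0 ≤ c) (h : HasFormBound K p c) (n : ℕ) :
    HasFormBound (fun x y : Fin n → α => ∏ i, K (x i) (y i)) p (c ^ n) := by
  induction n with
  | zero =>
    intro f g hf hg
    simp only [Finset.univ_unique, Finset.sum_singleton, Finset.univ_eq_empty, Finset.prod_empty,
      pow_zero, one_mul, one_div]
    rw [Real.rpow_rpow_inv (hf _) hp.ne', Real.rpow_rpow_inv (hg _) hp.ne']
  | succ n ih =>
    have := (h.prod hp (fun x y => Finset.prod_nonneg fun i _ => hK (x i) (y i)) hc ih).comp_equiv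
      (Fin.consEquiv fun _ => α).symm
    rw [pow_succ']
    convert this using 3 with x y
    rw [Fin.prod_univ_succ]
    rfl

lemma hasFormBound_pi {ι α : Type*} [Fintype ι] [Fintype α] [DecidableEq ι] {K : α → α → ℝ}
    {p c : ℝ} (hp : 0 < p) (hK : ∀ x y, 0 ≤ K x y) (hc : 0 ≤ c) (h : HasFormBound K p c) :
    HasFormBound (fun x y : ι → α => ∏ i, K (x i) (y i)) p (c ^ Fintype.card ι) := by
  let e := Fintype.equivFin ι
  have := (hasFormBound_pi_fin hp hK hc h (Fintype.card ι)).comp_equiv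
    (e.arrowCongr (Equiv.refl α))
  convert this using 3 with x y
  rw [← e.prod_comp]
  simp [Equiv.arrowCongr]

/-- The noise kernel on one bit. -/
lemma hasFormBound_bit {η : ℝ} (h0 : 0 ≤ η) (h1 : η < 1 / 2) :
    HasFormBound (fun x y : ZMod 2 => if x + y = 1 then η else 1 - η) (2 * (1 - η))
      (2 * ((1 / 2 : ℝ) ^ (1 / (2 * (1 - η)))) ^ 2) := by
  intro f g hf hg
  set p := 2 * (1 - η) with hp
  have hp1 : 1 < p := by linarith
  have hp2 : p ≤ 2 := by linarith
  have hF := two_point_inequality hp1 hp2 (hf 0) (hf 1)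
  have hG := two_point_inequality hp1 hp2 (hg 0) (hg 1)
  have hdiv : ∀ k : ZMod 2 → ℝ, (∀ x, 0 ≤ k x) → ((k 0 ^ p + k 1 ^ p) / 2) ^ (1 / p) =
      (1 / 2 : ℝ) ^ (1 / p) * (∑ x, k x ^ p) ^ (1 / p) := by
    intro k hk
    have hs : (∑ x : ZMod 2, k x ^ p) = k 0 ^ p + k 1 ^ p := Fin.sum_univ_two _
    rw [hs, ← Real.mul_rpow (by norm_num) (add_nonneg (Real.rpow_nonneg (hk _) _)
      (Real.rpow_nonneg (hk _) _))]
    congr 1; ring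
  rw [hdiv f hf] at hF
  rw [hdiv g hg] at hG
  have hsum : ∀ k : ZMod 2 → ℝ, ∑ x, k x = k 0 + k 1 := fun k => Fin.sum_univ_two _
  have h11 : (1 : ZMod 2) + 1 = 0 := rfl
  -- The kernel is diagonal in even and odd parts, and its factor on odd parts is `1 - 2η = p - 1`.
  -- This is why `p = 2(1 - η)` fits the two-point inequality.
  have hL : ∑ x : ZMod 2, ∑ y : ZMod 2, (if x + y = 1 then η else 1 - η) * f x * g y =
      2 * ((f 0 + f 1) / 2 * ((g 0 + g 1) / 2) +
        (p - 1) * ((f 0 - f 1) / 2 * ((g 0 - g 1) / 2))) := by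
    rw [hsum, hsum, hsum]
    simp only [add_zero, zero_add, h11, if_true, zero_ne_one, if_false]
    rw [hp]; ring
  rw [hL]
  set S := (∑ x, f x ^ p) ^ (1 / p)
  set T := (∑ x, g x ^ p) ^ (1 / p)
  set q := (1 / 2 : ℝ) ^ (1 / p)
  have hS : 0 ≤ S := Real.rpow_nonneg (Finset.sum_nonneg fun x _ => Real.rpow_nonneg (hf _) _) _
  have hT : 0 ≤ T := Real.rpow_nonneg (Finset.sum_nonneg fun x _ => Real.rpow_nonneg (hg _) _) _
  have hq : 0 ≤ q := by positivity
  have : (f 0 + f 1) / 2 * ((g 0 + g 1) / 2) + (p - 1) * ((f 0 - f 1) / 2 * ((g 0 - g 1) / 2)) ≤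
      (q * S) * (q * T) := by
    refine abs_le_of_sq_le_sq' ?_ (by positivity) |>.2
    have hp0 : 0 ≤ p - 1 := by linarith
    have hG0 : 0 ≤ ((g 0 + g 1) / 2) ^ 2 + (p - 1) * ((g 0 - g 1) / 2) ^ 2 := by positivity
    rw [mul_pow]
    refine le_trans ?_ (mul_le_mul hF hG hG0 (by positivity))
    -- Cauchy–Schwarz for the inner product with weights `1` and `p - 1`; the hint is the Lagrange
    -- remainder.
    nlinarith [mul_nonneg hp0 (sq_nonneg ((f 0 + f 1) / 2 * ((g 0 - g 1) / 2) -
      (f 0 - f 1) / 2 * ((g 0 + g 1) / 2)))]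
  calc _ ≤ 2 * (q * S * (q * T)) := by linarith
    _ = _ := by ring

/-! ### Bilocal values of a game played by each pair of players -/

section ThreePair
variable {X A : Type*} [Fintype X] [Fintype A]

lemma pairing_eq_sum (M P : Table₃ X A) :
    pairing M P = ∑ τ : X × X × X × A × A × A,
      M τ.1 τ.2.1 τ.2.2.1 τ.2.2.2.1 τ.2.2.2.2.1 τ.2.2.2.2.2 *
        P τ.1 τ.2.1 τ.2.2.1 τ.2.2.2.1 τ.2.2.2.2.1 τ.2.2.2.2.2 := by
  simp only [pairing, Fintype.sum_prod_type]

lemma pairing_add (M P P' : Table₃ X A) :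
    pairing M (fun x y z a b c => P x y z a b c + P' x y z a b c) =
      pairing M P + pairing M P' := by
  simp only [pairing_eq_sum, mul_add, Finset.sum_add_distrib]

lemma pairing_sum {S : Type*} (s : Finset S) (M : Table₃ X A) (P : S → Table₃ X A) :
    pairing M (fun x y z a b c => ∑ i ∈ s, P i x y z a b c) = ∑ i ∈ s, pairing M (P i) := by
  simp only [pairing_eq_sum, Finset.mul_sum]
  exact Finset.sum_comm

/-- A sum over the questions and answers of all three players, arranged instance by instance. -/
lemma sum_threePair (F : Table₂ X A) :
    ∑ x, ∑ y, ∑ z, ∑ a, ∑ b, ∑ c, threePair F x y z a b c = (∑ x, ∑ y, ∑ a, ∑ b, F x y a b) ^ 3 := by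
  have h1 : ∑ x, ∑ y, ∑ a, ∑ b, F x y a b =
      ∑ τ : X × X × A × A, F τ.1 τ.2.1 τ.2.2.1 τ.2.2.2 := by
    simp only [Fintype.sum_prod_type]
  have h2 : ∑ x, ∑ y, ∑ z, ∑ a, ∑ b, ∑ c, threePair F x y z a b c =
      ∑ τ : (X × X) × (X × X) × (X × X) × (A × A) × (A × A) × (A × A),
        threePair F τ.1 τ.2.1 τ.2.2.1 τ.2.2.2.1 τ.2.2.2.2.1 τ.2.2.2.2.2 := by
    simp only [Fintype.sum_prod_type (α₁ := X × X), Fintype.sum_prod_type (α₁ := A × A)]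
  let e : (X × X) × (X × X) × (X × X) × (A × A) × (A × A) × (A × A) ≃
      (X × X × A × A) × (X × X × A × A) × (X × X × A × A) :=
    ⟨fun ⟨x, y, z, a, b, c⟩ => ((x.1, y.1, a.1, b.1), (x.2, z.1, a.2, c.1), (y.2, z.2, b.2, c.2)),
      fun ⟨p, q, r⟩ => ((p.1, q.1), (p.2.1, r.1), (q.2.1, r.2.1), (p.2.2.1, q.2.2.1),
        (p.2.2.2, r.2.2.1), (q.2.2.2, r.2.2.2)), fun _ => rfl, fun _ => rfl⟩
  have h3 := Fintype.sum_equiv e (fun τ => threePair F τ.1 τ.2.1 τ.2.2.1 τ.2.2.2.1 τ.2.2.2.2.1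
    τ.2.2.2.2.2) (fun σ => F σ.1.1 σ.1.2.1 σ.1.2.2.1 σ.1.2.2.2 *
    F σ.2.1.1 σ.2.1.2.1 σ.2.1.2.2.1 σ.2.1.2.2.2 * F σ.2.2.1 σ.2.2.2.1 σ.2.2.2.2.1 σ.2.2.2.2.2)
    (fun _ => rfl)
  rw [h2, h1, h3]
  simp only [Fintype.sum_prod_type (α₁ := X × X × A × A), ← Finset.mul_sum, ← Finset.sum_mul]
  ring

/-- Coefficients dominated by a subprobability distribution of questions. -/
structure IsDominated (G : Table₂ X A) (M : X → X → ℝ) : Prop where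
  nonneg : ∀ x y a b, 0 ≤ G x y a b
  le : ∀ x y a b, G x y a b ≤ M x y
  bound_nonneg : ∀ x y, 0 ≤ M x y
  sum_le : ∑ x, ∑ y, M x y ≤ 1

omit [Fintype A] in
lemma IsDominated.threePair_nonneg {G : Table₂ X A} {M : X → X → ℝ} (h : IsDominated G M)
    (x y z : X × X) (a b c : A × A) : 0 ≤ threePair G x y z a b c :=
  mul_nonneg (mul_nonneg (h.nonneg _ _ _ _) (h.nonneg _ _ _ _)) (h.nonneg _ _ _ _)

omit [Fintype A] in
lemma IsDominated.isGame_threePair {G : Table₂ X A} {M : X → X → ℝ} (h : IsDominated G M) :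
    IsGame (threePair G) := by
  refine ⟨h.threePair_nonneg, ?_⟩
  calc _ ≤ ∑ x : X × X, ∑ y : X × X, ∑ z : X × X, M x.1 y.1 * M x.2 z.1 * M y.2 z.2 := by
        gcongr with x _ y _ z _
        refine Real.iSup_le (fun o => ?_) (mul_nonneg (mul_nonneg (h.bound_nonneg _ _)
          (h.bound_nonneg _ _)) (h.bound_nonneg _ _))
        exact mul_le_mul (mul_le_mul (h.le _ _ _ _) (h.le _ _ _ _) (h.nonneg _ _ _ _)
          (h.bound_nonneg _ _)) (h.le _ _ _ _) (h.nonneg _ _ _ _)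
          (mul_nonneg (h.bound_nonneg _ _) (h.bound_nonneg _ _))
    _ = (∑ x, ∑ y, M x y) ^ 3 := by
        -- A one-point answer alphabet reduces the identity to a sum over questions.
        simpa [threePair] using sum_threePair (fun x y (_ _ : Unit) => M x y)
    _ ≤ 1 := pow_le_one₀ (Finset.sum_nonneg fun _ _ => Finset.sum_nonneg fun _ _ =>
        h.bound_nonneg _ _) h.sum_le

/-- `V` bounds the classical value of two parallel instances of `G`. -/
def PairValueLE (G : Table₂ X A) (V : ℝ) : Prop :=
  ∀ f g : X × X → A × A → ℝ, IsCondProb f → IsCondProb g →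
    ∑ x, ∑ y, ∑ a, ∑ b, G x.1 y.1 a.1 b.1 * G x.2 y.2 a.2 b.2 * f x a * g y b ≤ V

/-- One player plays an instance with each of the other two, who cooperate; the third instance
does not help them. -/
lemma PairValueLE.lone_player {G : Table₂ X A} {M : X → X → ℝ} {V : ℝ} (hV0 : 0 ≤ V)
    (hV : PairValueLE G V) (h : IsDominated G M) {Q : X × X → A × A → ℝ}
    (hQ : IsCondProb Q) {R : (X × X) × (X × X) → (A × A) × (A × A) → ℝ} (hR : IsCondProb R) :
    ∑ τ : ((X × X) × (X × X) × (X × X)) × ((A × A) × (A × A) × (A × A)),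
      G τ.1.1.1 τ.1.2.1.1 τ.2.1.1 τ.2.2.1.1 * G τ.1.1.2 τ.1.2.1.2 τ.2.1.2 τ.2.2.1.2 *
        G τ.1.2.2.1 τ.1.2.2.2 τ.2.2.2.1 τ.2.2.2.2 *
        (Q τ.1.1 τ.2.1 * R (τ.1.2.1, τ.1.2.2) (τ.2.2.1, τ.2.2.2)) ≤ V := by
  -- `v` and `s` belong to the two instances shared with the lone player, `w` and `t` to the third.
  -- For fixed `w`, forgetting `t` leaves a strategy of one merged opponent.
  have hg : ∀ w, IsCondProb (fun v s => ∑ t, R (v, w) (s, t)) := fun w =>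
    ⟨fun v s => Finset.sum_nonneg fun t _ => hR.1 _ _, fun v => by
      rw [← Fintype.sum_prod_type']; exact hR.2 _⟩
  calc _ = ∑ w : X × X, ∑ x : X × X, ∑ v : X × X, ∑ a : A × A, ∑ s : A × A, ∑ t : A × A,
        G w.1 w.2 t.1 t.2 * (G x.1 v.1 a.1 s.1 * G x.2 v.2 a.2 s.2 * Q x a * R (v, w) (s, t)) := by
        have h1 : ∀ F : X × X → X × X → X × X → A × A → A × A → A × A → ℝ,
            ∑ w, ∑ x, ∑ v, ∑ a, ∑ s, ∑ t, F w x v a s t =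
              ∑ τ : (X × X) × (X × X) × (X × X) × (A × A) × (A × A) × (A × A),
                F τ.1 τ.2.1 τ.2.2.1 τ.2.2.2.1 τ.2.2.2.2.1 τ.2.2.2.2.2 := fun F => by
          simp only [Fintype.sum_prod_type (α₁ := X × X), Fintype.sum_prod_type (α₁ := A × A)]
        rw [h1]
        refine Fintype.sum_equiv ⟨fun ⟨⟨x, v, w⟩, ⟨a, s, t⟩⟩ => (w, x, v, a, s, t),
          fun ⟨w, x, v, a, s, t⟩ => ((x, v, w), (a, s, t)), fun _ => rfl, fun _ => rfl⟩ _ _ ?_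
        rintro ⟨⟨x, v, w⟩, ⟨a, s, t⟩⟩
        simp only [Equiv.coe_fn_mk]
        ring
    _ ≤ ∑ w : X × X, ∑ x : X × X, ∑ v : X × X, ∑ a : A × A, ∑ s : A × A, ∑ t : A × A,
        M w.1 w.2 * (G x.1 v.1 a.1 s.1 * G x.2 v.2 a.2 s.2 * Q x a * R (v, w) (s, t)) := by
        gcongr with w _ x _ v _ a _ s _ t _
        · exact mul_nonneg (mul_nonneg (mul_nonneg (h.nonneg _ _ _ _) (h.nonneg _ _ _ _))
            (hQ.1 _ _)) (hR.1 _ _)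
        · exact h.le _ _ _ _
    _ = ∑ w : X × X, M w.1 w.2 * ∑ x : X × X, ∑ v : X × X, ∑ a : A × A, ∑ s : A × A,
        G x.1 v.1 a.1 s.1 * G x.2 v.2 a.2 s.2 * Q x a * ∑ t : A × A, R (v, w) (s, t) := by
        simp only [Finset.mul_sum]
    _ ≤ ∑ w : X × X, M w.1 w.2 * V := by
        gcongr with w _
        · exact h.bound_nonneg _ _
        · exact hV _ _ hQ (hg w)
    _ = (∑ x, ∑ y, M x y) * V := by
        rw [← Finset.sum_mul, Fintype.sum_prod_type]
    _ ≤ V := mul_le_of_le_one_left hV0 h.sum_le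

lemma IsCondProb.comp_equiv {I I' O O' : Type*} [Fintype O] [Fintype O'] {R : I → O → ℝ}
    (hR : IsCondProb R) (f : I' → I) (e : O' ≃ O) : IsCondProb (fun i o => R (f i) (e o)) :=
  ⟨fun _ _ => hR.1 _ _, fun i => by rw [e.sum_comp (fun o => R (f i) o)]; exact hR.2 _⟩

/-- The bilocal strategies in the game played by each pair of players. -/
lemma PairValueLE.abs_pairing_threePair_le {G : Table₂ X A} {M : X → X → ℝ} {V : ℝ}
    (hV0 : 0 ≤ V) (hV : PairValueLE G V) (h : IsDominated G M)
    (hsymm : ∀ x y a b, G x y a b = G y x b a) {P : Table₃ (X × X) (A × A)}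
    (hP : P ∈ generalBilocal (X × X) (A × A)) : |pairing (threePair G) P| ≤ V := by
  rw [abs_of_nonneg (pairing_nonneg h.threePair_nonneg (generalBilocal_nonneg hP))]
  obtain ⟨m, p, Q, R, hp, hp1, hQ, hR, hPeq⟩ := hP
  obtain rfl : P = _ := by
    funext x y z a b c
    exact hPeq x y z a b c
  simp only [pairing_add, pairing_sum]
  have h0 : ∀ s, pairing (threePair G) (fun x y z a b c => p 0 s * Q 0 s x a *
      R 0 s (y, z) (b, c)) ≤ p 0 s * V := by
    intro s
    simp only [mul_assoc, pairing_const_mul]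
    refine mul_le_mul_of_nonneg_left ?_ (hp _ _)
    refine le_trans (le_of_eq ?_) (hV.lone_player hV0 h (hQ 0 s)
      ((hR 0 s).comp_equiv (Equiv.prodProdProdComm X X X X)
        (Equiv.prodProdProdComm A A A A)))
    rw [pairing_eq_sum]
    refine Fintype.sum_equiv ⟨fun ⟨x, y, z, a, b, c⟩ =>
        ((x, (y.1, z.1), (y.2, z.2)), (a, (b.1, c.1), (b.2, c.2))),
      fun ⟨⟨x, v, w⟩, ⟨a, s, t⟩⟩ => (x, (v.1, w.1), (v.2, w.2), a, (s.1, t.1), (s.2, t.2)),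
      fun _ => rfl, fun _ => rfl⟩ _ _ ?_
    rintro ⟨x, y, z, a, b, c⟩
    rfl
  have h1 : ∀ s, pairing (threePair G) (fun x y z a b c => p 1 s * Q 1 s y b *
      R 1 s (x, z) (a, c)) ≤ p 1 s * V := by
    intro s
    simp only [mul_assoc, pairing_const_mul]
    refine mul_le_mul_of_nonneg_left ?_ (hp _ _)
    -- The second player sits on the other side of the instance with the first, and the third on the
    -- other side of both instances; symmetry of `G` turns these around.
    refine le_trans (le_of_eq ?_) (hV.lone_player hV0 h (hQ 1 s) ((hR 1 s).comp_equiv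
      (fun o : (X × X) × (X × X) => ((o.1.1, o.2.1), (o.2.2, o.1.2)))
      (⟨fun o => ((o.1.1, o.2.1), (o.2.2, o.1.2)), fun o => ((o.1.1, o.2.2), (o.1.2, o.2.1)),
        fun _ => rfl, fun _ => rfl⟩ : (A × A) × (A × A) ≃ (A × A) × (A × A))))
    rw [pairing_eq_sum]
    refine Fintype.sum_equiv ⟨fun ⟨x, y, z, a, b, c⟩ =>
        ((y, (x.1, z.2), (x.2, z.1)), (b, (a.1, c.2), (a.2, c.1))),
      fun ⟨⟨y, v, w⟩, ⟨b, s, t⟩⟩ => ((v.1, w.1), y, (w.2, v.2), (s.1, t.1), b, (t.2, s.2)),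
      fun _ => rfl, fun _ => rfl⟩ _ _ ?_
    rintro ⟨x, y, z, a, b, c⟩
    simp only [threePair, Equiv.coe_fn_mk, hsymm y.1 x.1]
    ring
  have h2 : ∀ s, pairing (threePair G) (fun x y z a b c => p 2 s * Q 2 s z c *
      R 2 s (x, y) (a, b)) ≤ p 2 s * V := by
    intro s
    simp only [mul_assoc, pairing_const_mul]
    refine mul_le_mul_of_nonneg_left ?_ (hp _ _)
    refine le_trans (le_of_eq ?_) (hV.lone_player hV0 h (hQ 2 s) ((hR 2 s).comp_equiv
      (fun o : (X × X) × (X × X) => ((o.2.1, o.1.1), (o.2.2, o.1.2)))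
      (⟨fun o => ((o.2.1, o.1.1), (o.2.2, o.1.2)), fun o => ((o.1.2, o.2.2), (o.1.1, o.2.1)),
        fun _ => rfl, fun _ => rfl⟩ : (A × A) × (A × A) ≃ (A × A) × (A × A))))
    rw [pairing_eq_sum]
    refine Fintype.sum_equiv ⟨fun ⟨x, y, z, a, b, c⟩ =>
        ((z, (x.2, y.2), (x.1, y.1)), (c, (a.2, b.2), (a.1, b.1))),
      fun ⟨⟨z, v, w⟩, ⟨c, s, t⟩⟩ => ((w.1, v.1), (w.2, v.2), z, (t.1, s.1), (t.2, s.2), c),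
      fun _ => rfl, fun _ => rfl⟩ _ _ ?_
    rintro ⟨x, y, z, a, b, c⟩
    simp only [threePair, Equiv.coe_fn_mk, hsymm z.1 x.2, hsymm z.2 y.2]
    ring
  calc _ ≤ ∑ s, p 0 s * V + ∑ s, p 1 s * V + ∑ s, p 2 s * V :=
        add_le_add (add_le_add (Finset.sum_le_sum fun s _ => h0 s)
          (Finset.sum_le_sum fun s _ => h1 s)) (Finset.sum_le_sum fun s _ => h2 s)
    _ = (∑ j, ∑ s, p j s) * V := by
        simp only [Fin.sum_univ_three, add_mul, Finset.sum_mul]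
    _ = V := by rw [hp1, one_mul]

end ThreePair

/-! ### The Khot–Vishnoi game -/

section KhotVishnoi
variable {l : ℕ}

lemma cube_add_self (u : Cube l) : u + u = 0 := by
  ext t
  exact CharTwo.add_self_eq_zero _

lemma hadamardWord_injective (l : ℕ) : Function.Injective (hadamardWord l) := by
  intro s s' h
  ext i
  have := congrFun h (Pi.single i 1)
  simpa [hadamardWord, Pi.single_apply] using this

lemma mk_cosetElem (q : KVQuestion l) (s : KVAnswer l) :
    (QuotientAddGroup.mk (cosetElem q s) : KVQuestion l) = q := by
  have h : (QuotientAddGroup.mk (hadamardWord l s) : KVQuestion l) = 0 :=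
    (QuotientAddGroup.eq_zero_iff _).2 ⟨s, rfl⟩
  rw [cosetElem, QuotientAddGroup.mk_add, h, add_zero]
  exact Quotient.out_eq q

/-- An element of the cube is determined by its coset and its label. -/
def cosetEquiv (l : ℕ) : KVQuestion l × KVAnswer l ≃ Cube l :=
  Equiv.ofBijective (fun p => cosetElem p.1 p.2) <| by
    constructor
    · rintro ⟨q, s⟩ ⟨q', s'⟩ h
      obtain rfl : q = q' := by
        rw [← mk_cosetElem q s, ← mk_cosetElem q' s']
        exact congrArg _ h
      exact congrArg (Prod.mk q) (hadamardWord_injective l (add_left_cancel h))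
    · intro u
      have : (QuotientAddGroup.mk (Quotient.out (QuotientAddGroup.mk u : KVQuestion l)) :
          KVQuestion l) = QuotientAddGroup.mk u := Quotient.out_eq _
      obtain ⟨s, hs⟩ := QuotientAddGroup.eq.1 this
      refine ⟨(QuotientAddGroup.mk u, s), ?_⟩
      change Quotient.out (QuotientAddGroup.mk u : KVQuestion l) + hadamardWord l s = u
      rw [hs, add_neg_cancel_left]

@[simp] lemma cosetEquiv_apply (p : KVQuestion l × KVAnswer l) :
    cosetEquiv l p = cosetElem p.1 p.2 := rfl

lemma card_kvAnswer (l : ℕ) : Fintype.card (KVAnswer l) = 2 ^ l := by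
  simp [KVAnswer, ZMod.card]

lemma card_cube (l : ℕ) : Fintype.card (Cube l) = 2 ^ 2 ^ l := by
  simp [Cube, ZMod.card]

lemma card_kvQuestion_mul (l : ℕ) : Fintype.card (KVQuestion l) * 2 ^ l = 2 ^ 2 ^ l := by
  rw [← card_cube, ← Fintype.card_congr (cosetEquiv l), Fintype.card_prod, card_kvAnswer]

/-- Only `u = x` and `z` the sum of the two answers contribute; in characteristic two this `z`
automatically leads from the coset `x` to `y`. -/
lemma kvGame_apply (η : ℝ) (x y : KVQuestion l) (a b : KVAnswer l) :
    kvGame l η x y a b =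
      1 / (Fintype.card (KVQuestion l) : ℝ) * noiseProb η (cosetElem x a + cosetElem y b) := by
  have hxy : y = x + QuotientAddGroup.mk (cosetElem x a + cosetElem y b) := by
    have h := congrArg (QuotientAddGroup.mk : Cube l → KVQuestion l)
      (cube_add_self (cosetElem x a))
    rw [QuotientAddGroup.mk_add, mk_cosetElem] at h
    rw [QuotientAddGroup.mk_add, mk_cosetElem, mk_cosetElem, ← add_assoc, h]
    exact (zero_add y).symm
  rw [kvGame, Finset.sum_eq_single x, Finset.sum_eq_single (cosetElem x a + cosetElem y b)]
  · rw [if_pos ⟨rfl, hxy, rfl⟩]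
  · intro z _ hz
    rw [if_neg fun h => hz h.2.2.symm]
  · simp
  · intro u _ hu
    exact Finset.sum_eq_zero fun z _ => if_neg fun h => hu h.1.symm
  · simp

lemma kvGame_symm (η : ℝ) (x y : KVQuestion l) (a b : KVAnswer l) :
    kvGame l η x y a b = kvGame l η y x b a := by
  rw [kvGame_apply, kvGame_apply, add_comm (cosetElem x a)]

lemma noiseProb_nonneg {η : ℝ} (h0 : 0 ≤ η) (h1 : η ≤ 1) (z : Cube l) : 0 ≤ noiseProb η z :=
  Finset.prod_nonneg fun t _ => by split_ifs <;> linarith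

/-- Expectations of products of functions of the single coordinates. -/
lemma sum_noiseProb_mul_prod (η : ℝ) (g : (Fin l → ZMod 2) → ZMod 2 → ℝ) :
    ∑ z : Cube l, noiseProb η z * ∏ t, g t (z t) = ∏ t, ((1 - η) * g t 0 + η * g t 1) := by
  have h : ∀ t, (1 - η) * g t 0 + η * g t 1 =
      ∑ b : ZMod 2, (if b = 1 then η else 1 - η) * g t b := fun t => by
    rw [show (∑ b : ZMod 2, (if b = 1 then η else 1 - η) * g t b) =
      (if (0 : ZMod 2) = 1 then η else 1 - η) * g t 0 +
        (if (1 : ZMod 2) = 1 then η else 1 - η) * g t 1 from Fin.sum_univ_two _]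
    simp
  simp_rw [h]
  rw [Finset.prod_univ_sum, Fintype.piFinset_univ]
  simp_rw [noiseProb, ← Finset.prod_mul_distrib]

lemma sum_noiseProb (η : ℝ) : ∑ z : Cube l, noiseProb η z = 1 := by
  simpa using sum_noiseProb_mul_prod (l := l) η (fun _ _ => 1)

/-- The probability that the two questions are asked. -/
def kvQuestionProb (l : ℕ) (η : ℝ) (x y : KVQuestion l) : ℝ :=
  1 / (Fintype.card (KVQuestion l) : ℝ) * ∑ s, noiseProb η (cosetElem (x + y) s)

/-- The sum of the two answers lies in the coset `x + y`, so its probability is one term of the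
probability of that coset. The total mass is `1` because the cosets partition the cube. -/
lemma isDominated_kvGame {η : ℝ} (h0 : 0 ≤ η) (h1 : η ≤ 1) :
    IsDominated (kvGame l η) (kvQuestionProb l η) where
  nonneg x y a b := by
    rw [kvGame_apply]
    exact mul_nonneg (by positivity) (noiseProb_nonneg h0 h1 _)
  le x y a b := by
    rw [kvGame_apply, kvQuestionProb]
    gcongr
    obtain ⟨⟨q, s⟩, hs⟩ := (cosetEquiv l).surjective (cosetElem x a + cosetElem y b)
    rw [cosetEquiv_apply] at hs
    have hq : q = x + y := by
      have := congrArg (QuotientAddGroup.mk : Cube l → KVQuestion l) hs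
      rwa [QuotientAddGroup.mk_add, mk_cosetElem, mk_cosetElem, mk_cosetElem] at this
    rw [← hs, ← hq]
    exact Finset.single_le_sum (f := fun s => noiseProb η (cosetElem q s))
      (fun s _ => noiseProb_nonneg h0 h1 _) (Finset.mem_univ s)
  bound_nonneg x y :=
    mul_nonneg (by positivity) (Finset.sum_nonneg fun _ _ => noiseProb_nonneg h0 h1 _)
  sum_le := by
    have h : ∀ x : KVQuestion l, ∑ y, ∑ s, noiseProb η (cosetElem (x + y) s) = 1 := by
      intro x
      calc _ = ∑ y : KVQuestion l, ∑ s, noiseProb η (cosetElem y s) :=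
            Equiv.sum_comp (Equiv.addLeft x) (fun y => ∑ s, noiseProb η (cosetElem y s))
        _ = 1 := by
            rw [← Fintype.sum_prod_type', ← sum_noiseProb (l := l) η, ← (cosetEquiv l).sum_comp]
            rfl
    simp only [kvQuestionProb, ← Finset.mul_sum, h]
    simp

/-- The noise operator on the cube. -/
lemma hasFormBound_noiseProb {η : ℝ} (h0 : 0 ≤ η) (h1 : η < 1 / 2) :
    HasFormBound (fun u v : Cube l => noiseProb η (u + v)) (2 * (1 - η))
      ((2 * ((1 / 2 : ℝ) ^ (1 / (2 * (1 - η)))) ^ 2) ^ 2 ^ l) := by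
  have := hasFormBound_pi (ι := Fin l → ZMod 2) (by linarith)
    (fun x y => by split_ifs <;> linarith) (by positivity) (hasFormBound_bit h0 h1)
  rwa [show Fintype.card (Fin l → ZMod 2) = 2 ^ l from card_kvAnswer l] at this

/-- The classical value of two parallel instances of the Khot–Vishnoi game. -/
lemma pairValueLE_kvGame {η : ℝ} (h0 : 0 ≤ η) (h1 : η < 1 / 2) :
    PairValueLE (kvGame l η) (((2 : ℝ) ^ l) ^ (2 - 4 / (2 * (1 - η)))) := by
  intro f g hf hg
  set p := 2 * (1 - η) with hp
  have hp1 : 1 < p := by linarith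
  have hp0 : 0 < p := by linarith
  set c : ℝ := (2 * ((1 / 2 : ℝ) ^ (1 / p)) ^ 2) ^ 2 ^ l with hc
  have hc0 : 0 ≤ c := by positivity
  -- A question with its answer is a point of the cube, so a strategy for two instances is a
  -- function on two cubes.
  let e : (KVQuestion l × KVQuestion l) × (KVAnswer l × KVAnswer l) ≃ Cube l × Cube l :=
    (Equiv.prodProdProdComm _ _ _ _).trans ((cosetEquiv l).prodCongr (cosetEquiv l))
  have hb := ((((hasFormBound_noiseProb (l := l) h0 h1).prod hp0
    (fun _ _ => noiseProb_nonneg h0 (by linarith) _) hc0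
    (hasFormBound_noiseProb h0 h1))).comp_equiv e) (fun i => f i.1 i.2) (fun i => g i.1 i.2)
    (fun i => hf.1 _ _) (fun i => hg.1 _ _)
  obtain ⟨N, hN⟩ : ∃ N : ℝ, N = Fintype.card (KVQuestion l) := ⟨_, rfl⟩
  have hNpos : 0 < N := by rw [hN]; exact_mod_cast Fintype.card_pos
  -- Since `0 ≤ f ≤ 1` and `p > 1`, `f^p ≤ f`, whose sum is `1` for each of the `N²` question pairs.
  have hsum : ∀ f : KVQuestion l × KVQuestion l → KVAnswer l × KVAnswer l → ℝ, IsCondProb f →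
      (∑ i : (KVQuestion l × KVQuestion l) × (KVAnswer l × KVAnswer l), f i.1 i.2 ^ p) ^ (1 / p) ≤
        (N ^ 2) ^ (1 / p) := by
    intro f hf
    refine Real.rpow_le_rpow (Finset.sum_nonneg fun i _ => Real.rpow_nonneg (hf.1 _ _) _) ?_
      (by positivity)
    calc _ ≤ ∑ i : (KVQuestion l × KVQuestion l) × (KVAnswer l × KVAnswer l), f i.1 i.2 :=
          Finset.sum_le_sum fun i _ =>
            Real.rpow_le_self_of_le_one (hf.1 _ _) (hf.le_one _ _) hp1.le
      _ = N ^ 2 := by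
          rw [Fintype.sum_prod_type]
          simp [hf.2, hN, sq]
  calc _ = (1 / N) ^ 2 * ∑ i : (KVQuestion l × KVQuestion l) × (KVAnswer l × KVAnswer l),
        ∑ j : (KVQuestion l × KVQuestion l) × (KVAnswer l × KVAnswer l),
          noiseProb η ((e i).1 + (e j).1) * noiseProb η ((e i).2 + (e j).2) *
            f i.1 i.2 * g j.1 j.2 := by
        simp only [Fintype.sum_prod_type (α₁ := KVQuestion l × KVQuestion l), Finset.mul_sum]
        refine Finset.sum_congr rfl fun x _ => ?_
        rw [Finset.sum_comm]
        refine Finset.sum_congr rfl fun y _ => Finset.sum_congr rfl fun a _ =>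
          Finset.sum_congr rfl fun b _ => ?_
        rw [kvGame_apply, kvGame_apply]
        simp only [e, Equiv.trans_apply, Equiv.prodProdProdComm_apply, Equiv.prodCongr_apply,
          Prod.map_apply, cosetEquiv_apply, hN]
        ring
    _ ≤ (1 / N) ^ 2 * (c * c * (N ^ 2) ^ (1 / p) * (N ^ 2) ^ (1 / p)) := by
        refine mul_le_mul_of_nonneg_left (hb.trans ?_) (by positivity)
        have h2 := hsum f hf
        have h3 := hsum g hg
        have h4 : (0 : ℝ) ≤ (∑ i : (KVQuestion l × KVQuestion l) × (KVAnswer l × KVAnswer l),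
          g i.1 i.2 ^ p) ^ (1 / p) :=
          Real.rpow_nonneg (Finset.sum_nonneg fun i _ => Real.rpow_nonneg (hg.1 _ _) _) _
        gcongr
    _ = _ := by
        have hNn : N * (2 : ℝ) ^ l = 2 ^ 2 ^ l := by
          rw [hN]; exact_mod_cast card_kvQuestion_mul l
        set n : ℝ := (2 : ℝ) ^ l with hn
        have hn0 : 0 < n := by positivity
        -- The bound becomes `N^(-2) (N n)^(2 - 4/p) N^(4/p)`, in which all powers of `N` cancel.
        have hcc : c = N * n * ((N * n) ^ (-(2 / p))) := by
          rw [hc, mul_pow, ← hNn, ← pow_mul, ← Real.rpow_natCast (_ ^ (1 / p)),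
            ← Real.rpow_mul (by norm_num)]
          congr 1
          rw [hNn, ← Real.rpow_natCast (2 : ℝ) (2 ^ l), ← Real.rpow_mul (by norm_num), one_div,
            Real.inv_rpow (by norm_num), ← Real.rpow_neg (by norm_num)]
          congr 1
          push_cast
          ring
        have hNN : (N ^ 2) ^ (1 / p) = N ^ (2 / p) := by
          rw [← Real.rpow_natCast N 2, ← Real.rpow_mul hNpos.le]
          congr 1
          push_cast
          ring
        rw [hcc, hNN, Real.mul_rpow hNpos.le hn0.le, Real.rpow_neg hNpos.le,
          Real.rpow_neg hn0.le]
        have hA : N ^ (2 / p) ≠ 0 := (Real.rpow_pos_of_pos hNpos _).ne'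
        have hB : n ^ (2 / p) ≠ 0 := (Real.rpow_pos_of_pos hn0 _).ne'
        have : n ^ (2 - 4 / p) = n ^ 2 / (n ^ (2 / p) * n ^ (2 / p)) := by
          rw [Real.rpow_sub hn0, ← Real.rpow_add hn0, Real.rpow_two]
          congr 2
          ring
        rw [this]
        field_simp

end KhotVishnoi

/-! ### Three maximally entangled pairs -/

lemma sum_pairs {S : Type*} [Fintype S] (F₁ F₂ F₃ : S → S → ℝ) :
    ∑ x : S × S, ∑ y : S × S, ∑ z : S × S, F₁ x.1 y.1 * F₂ x.2 z.1 * F₃ y.2 z.2 =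
      (∑ i, ∑ j, F₁ i j) * (∑ i, ∑ j, F₂ i j) * ∑ i, ∑ j, F₃ i j := by
  have h1 : ∀ F : S → S → ℝ, ∑ i, ∑ j, F i j = ∑ p : S × S, F p.1 p.2 := fun F =>
    (Fintype.sum_prod_type' F).symm
  have h2 := Fintype.sum_equiv (⟨fun ⟨x, y, z⟩ => ((x.1, y.1), (x.2, z.1), (y.2, z.2)),
      fun ⟨p, q, r⟩ => ((p.1, q.1), (p.2, r.1), (q.2, r.2)), fun _ => rfl, fun _ => rfl⟩ :
      (S × S) × (S × S) × (S × S) ≃ (S × S) × (S × S) × (S × S))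
    (fun τ => F₁ τ.1.1 τ.2.1.1 * F₂ τ.1.2 τ.2.2.1 * F₃ τ.2.1.2 τ.2.2.2)
    (fun τ => F₁ τ.1.1 τ.1.2 * F₂ τ.2.1.1 τ.2.1.2 * F₃ τ.2.2.1 τ.2.2.2) (fun _ => rfl)
  rw [h1, h1, h1]
  simp only [Fintype.sum_prod_type (α₁ := S × S), ← Finset.mul_sum, ← Finset.sum_mul] at h2 ⊢
  exact h2

/-- Real orthonormal bases, indexed by the questions: the completeness relation. -/
def IsBasisFamily {X A S : Type*} [Fintype A] [DecidableEq S] (v : X → A → S → ℝ) : Prop :=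
  ∀ x i j, ∑ a, v x a i * v x a j = if i = j then 1 else 0

/-- The outcome probabilities when two players measure a maximally entangled state. -/
def entangledProb {X A S : Type*} [Fintype S] (v : X → A → S → ℝ) : Table₂ X A :=
  fun x y a b => (Fintype.card S : ℝ)⁻¹ * (∑ i, v x a i * v y b i) ^ 2

lemma isPOVM_of_isBasisFamily {X A S : Type*} [Fintype A] [DecidableEq S]
    {v : X → A → S → ℝ} (hv : IsBasisFamily v) {d : ℕ} (e : Fin d ≃ S × S) :
    IsPOVM (fun (x : X × X) (a : A × A) => Matrix.vecMulVec
      (fun i => ((v x.1 a.1 (e i).1 * v x.2 a.2 (e i).2 : ℝ) : ℂ))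
      (star fun i => ((v x.1 a.1 (e i).1 * v x.2 a.2 (e i).2 : ℝ) : ℂ))) := by
  refine ⟨fun x a => Matrix.posSemidef_vecMulVec_self_star _, fun x => ?_⟩
  ext i j
  have h := congrArg₂ (fun r s : ℝ => ((r * s : ℝ) : ℂ)) (hv x.1 (e i).1 (e j).1)
    (hv x.2 (e i).2 (e j).2)
  simp only [Fintype.sum_mul_sum] at h
  simp only [Matrix.sum_apply, Matrix.vecMulVec_apply, Pi.star_apply, Fintype.sum_prod_type,
    RCLike.star_def, Complex.conj_ofReal, ← Complex.ofReal_mul, ← Complex.ofReal_sum]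
  calc _ = _ := by
        congr 1
        exact Finset.sum_congr rfl fun a _ => Finset.sum_congr rfl fun b _ =>
          mul_mul_mul_comm _ _ _ _
    _ = _ := h
    _ = _ := by
        rw [Matrix.one_apply]
        by_cases hij : i = j
        · simp [hij]
        · have : ¬((e i).1 = (e j).1 ∧ (e i).2 = (e j).2) := fun h' =>
            hij (e.injective (Prod.ext h'.1 h'.2))
          rw [if_neg hij]
          by_cases h1 : (e i).1 = (e j).1
          · have h2 : (e i).2 ≠ (e j).2 := fun h2 => this ⟨h1, h2⟩
            simp [h2]
          · simp [h1]

/-- Each player holds halves of two maximally entangled pairs and measures both in a product basis.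
State and bases are real and the operators are rank-one projections onto product vectors, so each
probability is the square of an amplitude that factors over the three pairs. -/
lemma threePair_entangledProb_mem_quantumOfDim {X A S : Type*} [Fintype A] [Fintype S]
    [DecidableEq S] [Nonempty S] {v : X → A → S → ℝ} (hv : IsBasisFamily v) {d : ℕ}
    (e : Fin d ≃ S × S) :
    threePair (entangledProb v) ∈ quantumOfDim (X × X) (A × A) d d d := by
  obtain ⟨n, hn⟩ : ∃ n : ℝ, n = Fintype.card S := ⟨_, rfl⟩
  have hn0 : 0 < n := by rw [hn]; exact_mod_cast Fintype.card_pos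
  set κ : ℝ := (√n)⁻¹ with hκ
  have hκ2 : κ ^ 2 = n⁻¹ := by rw [hκ, inv_pow, Real.sq_sqrt hn0.le]
  let δ : S → S → ℝ := fun i j => if i = j then κ else 0
  let φ : Fin d × Fin d × Fin d → ℝ := fun p =>
    δ (e p.1).1 (e p.2.1).1 * δ (e p.1).2 (e p.2.2).1 * δ (e p.2.1).2 (e p.2.2).2
  have hsum : ∀ f : S × S → S × S → S × S → ℝ,
      ∑ p : Fin d × Fin d × Fin d, f (e p.1) (e p.2.1) (e p.2.2) =
        ∑ x, ∑ y, ∑ z, f x y z := by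
    intro f
    simp only [Fintype.sum_prod_type (α₁ := Fin d)]
    rw [← e.sum_comp]
    refine Finset.sum_congr rfl fun i _ => ?_
    rw [← e.sum_comp]
    refine Finset.sum_congr rfl fun j _ => ?_
    rw [← e.sum_comp]
  have hnorm : ∑ p, φ p * φ p = 1 := by
    have h := sum_pairs (fun i j => δ i j * δ i j) (fun i j => δ i j * δ i j)
      (fun i j => δ i j * δ i j)
    have h1 : ∑ i, ∑ j, δ i j * δ i j = 1 := by
      simp only [δ, ← sq, ite_pow, hκ2]
      simp [← hn, hn0.ne']
    rw [h1] at h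
    rw [← mul_one (1 : ℝ), ← mul_one ((1 : ℝ) * 1), ← h, ← hsum]
    exact Finset.sum_congr rfl fun p _ => by ring
  refine ⟨fun p => (φ p : ℂ), _, _, _, ?_, isPOVM_of_isBasisFamily hv e,
    isPOVM_of_isBasisFamily hv e, isPOVM_of_isBasisFamily hv e, ?_⟩
  · rw [← Complex.ofReal_one, ← hnorm]
    simp [dotProduct]
  · intro x y z a b c
    let W : X × X → A × A → S × S → ℝ := fun x a i => v x.1 a.1 i.1 * v x.2 a.2 i.2
    let U : Fin d × Fin d × Fin d → ℝ := fun p =>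
      W x a (e p.1) * (W y b (e p.2.1) * W z c (e p.2.2))
    have hamp : ∑ p, φ p * U p = κ ^ 3 * ((∑ i, v x.1 a.1 i * v y.1 b.1 i) *
        (∑ i, v x.2 a.2 i * v z.1 c.1 i) * ∑ i, v y.2 b.2 i * v z.2 c.2 i) := by
      have h := sum_pairs (fun i j => δ i j * (v x.1 a.1 i * v y.1 b.1 j))
        (fun i j => δ i j * (v x.2 a.2 i * v z.1 c.1 j))
        (fun i j => δ i j * (v y.2 b.2 i * v z.2 c.2 j))
      have h1 : ∀ f g : S → ℝ, ∑ i, ∑ j, δ i j * (f i * g j) = κ * ∑ i, f i * g i := by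
        intro f g
        simp [δ, Finset.mul_sum]
      simp only [h1] at h
      calc _ = _ := (Finset.sum_congr rfl fun p _ => by simp only [φ, U, W]; ring).trans (hsum _)
        _ = _ := h
        _ = _ := by ring
    have hP : threePair (entangledProb v) x y z a b c = (∑ p, φ p * U p) ^ 2 := by
      rw [hamp, mul_pow, ← pow_mul, mul_comm 3 2, pow_mul, hκ2]
      simp only [threePair, entangledProb, ← hn]
      ring
    rw [hP, sq, Fintype.sum_mul_sum]
    simp only [dotProduct, Matrix.mulVec, Matrix.kroneckerMap_apply, Matrix.vecMulVec_apply,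
      Pi.star_apply, RCLike.star_def, Complex.conj_ofReal, Complex.ofReal_sum, Finset.mul_sum]
    refine Finset.sum_congr rfl fun p _ => Finset.sum_congr rfl fun q _ => ?_
    simp only [U, W, Complex.ofReal_mul]
    ring

/-! ### The quantum strategy in the Khot–Vishnoi game -/

section KhotVishnoi
variable {l : ℕ}

/-- The sign character of a bit. -/
def bitSign : AddChar (ZMod 2) ℝ where
  toFun b := if b = 1 then -1 else 1
  map_zero_eq_one' := by simp
  map_add_eq_mul' a b := by
    have h : ∀ b : ZMod 2, b = 0 ∨ b = 1 := by decide
    rcases h a with rfl | rfl <;> rcases h b with rfl | rfl <;> simp [CharTwo.add_self_eq_zero]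

@[simp] lemma bitSign_one : bitSign 1 = -1 :=
  show (if (1 : ZMod 2) = 1 then (-1 : ℝ) else 1) = -1 from if_pos rfl

lemma bitSign_mul_self (b : ZMod 2) : bitSign b * bitSign b = 1 := by
  rw [← AddChar.map_add_eq_mul, CharTwo.add_self_eq_zero, AddChar.map_zero_eq_one]

lemma hadamardWord_comm (s t : Fin l → ZMod 2) : hadamardWord l s t = hadamardWord l t s :=
  show ∑ i, s i * t i = ∑ i, t i * s i from Finset.sum_congr rfl fun _ _ => mul_comm _ _

/-- `s ↦ (-1)^(s·t)` is a character, trivial only for `t = 0` because `s·t` is symmetric and the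
Hadamard code is injective. -/
lemma sum_bitSign_hadamardWord (t : Fin l → ZMod 2) :
    ∑ s : KVAnswer l, bitSign (hadamardWord l s t) = if t = 0 then 2 ^ l else 0 := by
  classical
  let ψ : AddChar (Fin l → ZMod 2) ℝ := bitSign.compAddMonoidHom
    ((Pi.evalAddMonoidHom (fun _ : Fin l → ZMod 2 => ZMod 2) t).comp (hadamardWord l))
  have h := AddChar.sum_eq_ite ψ
  change ∑ s, bitSign (hadamardWord l s t) = _ at h
  rw [h]
  split_ifs with h1 h2 h2
  · exact_mod_cast card_kvAnswer l
  · exfalso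
    refine h2 (hadamardWord_injective l ?_)
    ext s
    have h3 : bitSign (hadamardWord l s t) = 1 := DFunLike.congr_fun h1 s
    rw [map_zero, ← hadamardWord_comm]
    by_contra h0
    have h4 : ∀ b : ZMod 2, b ≠ 0 → b = 1 := by decide
    rw [h4 _ h0, bitSign_one] at h3
    norm_num at h3
  · exfalso
    refine h1 (DFunLike.ext _ _ fun s => ?_)
    change bitSign (hadamardWord l s t) = 1
    rw [h2, hadamardWord_comm, map_zero, Pi.zero_apply, AddChar.map_zero_eq_one]
  · rfl

/-- The measurement bases: sign vectors of the elements of the cosets. -/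
def kvVector (l : ℕ) (q : KVQuestion l) (s : KVAnswer l) (t : Fin l → ZMod 2) : ℝ :=
  (√(2 ^ l))⁻¹ * bitSign (cosetElem q s t)

/-- The signs of the coset representative factor out, leaving the orthogonality of the columns of a
Hadamard matrix. -/
lemma isBasisFamily_kvVector (l : ℕ) : IsBasisFamily (kvVector l) := by
  intro q t t'
  have h : ∀ s, kvVector l q s t * kvVector l q s t' =
      (2 ^ l)⁻¹ * (bitSign (Quotient.out q t) * bitSign (Quotient.out q t')) *
        bitSign (hadamardWord l s (t + t')) := by
    intro s
    have h1 : hadamardWord l s (t + t') = hadamardWord l s t + hadamardWord l s t' := by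
      rw [hadamardWord_comm, map_add, Pi.add_apply, hadamardWord_comm t, hadamardWord_comm t']
    have h2 : ((√(2 ^ l))⁻¹ : ℝ) * (√(2 ^ l))⁻¹ = (2 ^ l)⁻¹ := by
      rw [← mul_inv, Real.mul_self_sqrt (by positivity)]
    rw [kvVector, kvVector, cosetElem, Pi.add_apply, Pi.add_apply, AddChar.map_add_eq_mul,
      AddChar.map_add_eq_mul, h1, AddChar.map_add_eq_mul, ← h2]
    ring
  simp only [h]
  rw [← Finset.mul_sum, sum_bitSign_hadamardWord]
  have h3 : t + t' = 0 ↔ t = t' := by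
    rw [add_eq_zero_iff_eq_neg, show -t' = t' from funext fun i => ZMod.neg_eq_self_mod_two _]
  simp only [h3]
  split_ifs with htt
  · rw [htt, bitSign_mul_self]
    field_simp
  · simp

lemma entangledProb_kvVector (x y : KVQuestion l) (a b : KVAnswer l) :
    entangledProb (kvVector l) x y a b =
      (2 ^ l)⁻¹ * ((2 ^ l)⁻¹ * ∑ t, bitSign ((cosetElem x a + cosetElem y b) t)) ^ 2 := by
  have h2 : ((√(2 ^ l))⁻¹ : ℝ) * (√(2 ^ l))⁻¹ = (2 ^ l)⁻¹ := by
    rw [← mul_inv, Real.mul_self_sqrt (by positivity)]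
  rw [entangledProb, show Fintype.card (Fin l → ZMod 2) = 2 ^ l from card_kvAnswer l,
    Finset.mul_sum]
  push_cast
  congr 2
  refine Finset.sum_congr rfl fun t _ => ?_
  rw [kvVector, kvVector, Pi.add_apply, AddChar.map_add_eq_mul, ← h2]
  ring

lemma sum_noiseProb_mul_bitSign (η : ℝ) (t : Fin l → ZMod 2) :
    ∑ z : Cube l, noiseProb η z * bitSign (z t) = 1 - 2 * η := by
  have h := sum_noiseProb_mul_prod (l := l) η (fun t' b => if t' = t then bitSign b else 1)
  have h1 : ∀ t', ((1 - η) * (if t' = t then bitSign 0 else 1) +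
      η * (if t' = t then bitSign 1 else 1)) = if t' = t then 1 - 2 * η else 1 := by
    intro t'
    split_ifs
    · rw [AddChar.map_zero_eq_one, bitSign_one]; ring
    · ring
  simp only [h1] at h
  simpa using h

/-- The value of the quantum strategy in one instance. -/
lemma le_value_entangledProb {η : ℝ} (h0 : 0 ≤ η) (h1 : η ≤ 1) :
    (1 - 2 * η) ^ 2 ≤
      ∑ x, ∑ y, ∑ a, ∑ b, kvGame l η x y a b * entangledProb (kvVector l) x y a b := by
  set f : Cube l → ℝ := fun z => (2 ^ l)⁻¹ * ∑ t, bitSign (z t) with hf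
  obtain ⟨N, hN⟩ : ∃ N : ℝ, N = Fintype.card (KVQuestion l) := ⟨_, rfl⟩
  have hN0 : 0 < N := by rw [hN]; exact_mod_cast Fintype.card_pos
  have hNn : N * (2 : ℝ) ^ l = Fintype.card (Cube l) := by
    rw [hN, card_cube]; exact_mod_cast card_kvQuestion_mul l
  have hval : ∑ x, ∑ y, ∑ a, ∑ b, kvGame l η x y a b * entangledProb (kvVector l) x y a b =
      ∑ z : Cube l, noiseProb η z * f z ^ 2 := by
    -- Everything depends only on `u + v`, so the `N n` choices of `u` cancel the normalisation and
    -- leave an expectation over the noise.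
    calc _ = ∑ u : Cube l, ∑ v : Cube l, (N * 2 ^ l)⁻¹ * (noiseProb η (u + v) * f (u + v) ^ 2) := by
          rw [← (cosetEquiv l).sum_comp, Fintype.sum_prod_type]
          refine Finset.sum_congr rfl fun x _ => ?_
          rw [Finset.sum_comm]
          refine Finset.sum_congr rfl fun a _ => ?_
          rw [← (cosetEquiv l).sum_comp, Fintype.sum_prod_type]
          refine Finset.sum_congr rfl fun y _ => Finset.sum_congr rfl fun b _ => ?_
          rw [kvGame_apply, entangledProb_kvVector]
          simp only [cosetEquiv_apply, hf, ← hN, mul_inv]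
          ring
      _ = ∑ u : Cube l, (N * 2 ^ l)⁻¹ * ∑ z : Cube l, noiseProb η z * f z ^ 2 := by
          refine Finset.sum_congr rfl fun u _ => ?_
          rw [← Finset.mul_sum]
          congr 1
          exact Equiv.sum_comp (Equiv.addLeft u) (fun z => noiseProb η z * f z ^ 2)
      _ = _ := by
          rw [Finset.sum_const, Finset.card_univ, nsmul_eq_mul, ← mul_assoc, ← hNn,
            mul_inv_cancel₀ (by positivity), one_mul]
  have hmean : ∑ z : Cube l, noiseProb η z * f z = 1 - 2 * η := by
    calc _ = (2 ^ l)⁻¹ * ∑ t : Fin l → ZMod 2, ∑ z : Cube l, noiseProb η z * bitSign (z t) := by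
          rw [Finset.sum_comm, Finset.mul_sum]
          refine Finset.sum_congr rfl fun z _ => ?_
          rw [← Finset.mul_sum, hf]
          ring
      _ = _ := by
          simp only [sum_noiseProb_mul_bitSign]
          rw [Finset.sum_const, Finset.card_univ, nsmul_eq_mul,
            show Fintype.card (Fin l → ZMod 2) = 2 ^ l from card_kvAnswer l]
          push_cast
          rw [inv_mul_cancel_left₀ (by positivity)]
  rw [hval]
  -- Non-negativity of the variance: the second moment of the mean sign is at least the square of
  -- its mean `1 - 2η`.
  have hvar : 0 ≤ ∑ z : Cube l, noiseProb η z * (f z - (1 - 2 * η)) ^ 2 :=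
    Finset.sum_nonneg fun z _ => mul_nonneg (noiseProb_nonneg h0 h1 z) (sq_nonneg _)
  have hexp : ∑ z : Cube l, noiseProb η z * (f z - (1 - 2 * η)) ^ 2 =
      ∑ z : Cube l, noiseProb η z * f z ^ 2 - 2 * (1 - 2 * η) * ∑ z : Cube l, noiseProb η z * f z +
        (1 - 2 * η) ^ 2 * ∑ z : Cube l, noiseProb η z := by
    rw [Finset.mul_sum, Finset.mul_sum, ← Finset.sum_sub_distrib, ← Finset.sum_add_distrib]
    exact Finset.sum_congr rfl fun z _ => by ring
  rw [hmean, sum_noiseProb] at hexp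
  nlinarith

/-- The value of the quantum strategy in the tripartite game. -/
lemma le_pairing_entangledProb {η : ℝ} (h0 : 0 ≤ η) (h1 : η ≤ 1) :
    (1 - 2 * η) ^ 6 ≤
      pairing (threePair (kvGame l η)) (threePair (entangledProb (kvVector l))) := by
  have h : pairing (threePair (kvGame l η)) (threePair (entangledProb (kvVector l))) =
      (∑ x, ∑ y, ∑ a, ∑ b, kvGame l η x y a b * entangledProb (kvVector l) x y a b) ^ 3 := by
    rw [← sum_threePair, pairing]
    simp only [threePair]
    refine Finset.sum_congr rfl fun x _ => Finset.sum_congr rfl fun y _ => Finset.sum_congr rfl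
      fun z _ => Finset.sum_congr rfl fun a _ => Finset.sum_congr rfl fun b _ =>
      Finset.sum_congr rfl fun c _ => by ring
  rw [h, show 6 = 2 * 3 from rfl, pow_mul]
  exact pow_le_pow_left₀ (sq_nonneg _) (le_value_entangledProb h0 h1) 3

end KhotVishnoi

/-! ### The violation -/

lemma kvNoise_lt_half {β : ℝ} (hβ : 1 < β) {l : ℕ} (hl : 1 ≤ l) : kvNoise β l < 1 / 2 := by
  have : 0 < Real.logb β ((2 : ℝ) ^ l) :=
    Real.logb_pos hβ (one_lt_pow₀ one_lt_two (by omega))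
  rw [kvNoise]
  linarith [one_div_pos.2 this]

lemma isGame_kvTripartite {β : ℝ} (hβ : 1 < β) {l : ℕ} (hl : 1 ≤ l) (h0 : 0 ≤ kvNoise β l) :
    IsGame (kvTripartite β l) :=
  (isDominated_kvGame h0 (by linarith [kvNoise_lt_half hβ hl])).isGame_threePair

/-- With `ε = 1/log_β n`, `p = 1 + 2ε` and the exponent `2 - 4/p` is at most `-2 + 8ε`, the gap
being `16ε²/(1 + 2ε)`. As `n^ε = β`, the noise rate costs only the constant `β^8`. -/
lemma bellValue_generalBilocal_kvTripartite_le {β : ℝ} (hβ : 1 < β) {l : ℕ} (hl : 1 ≤ l)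
    (h0 : 0 ≤ kvNoise β l) :
    bellValue (generalBilocal _ _) (kvTripartite β l) ≤ β ^ 8 / ((2 : ℝ) ^ l) ^ 2 := by
  have h1 := kvNoise_lt_half hβ hl
  set n : ℝ := (2 : ℝ) ^ l with hn
  have hn1 : 1 < n := one_lt_pow₀ one_lt_two (by omega)
  have hn0 : 0 < n := by linarith
  have hL : 0 < Real.logb β n := Real.logb_pos hβ hn1
  have hη : kvNoise β l = 1 / 2 - 1 / Real.logb β n := rfl
  set ε := 1 / Real.logb β n with hε
  have hε0 : 0 < ε := one_div_pos.2 hL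
  have hnε : n ^ (8 * ε) = β ^ 8 := by
    have hβ0 : 0 < β := by linarith
    conv_lhs => rw [← Real.rpow_logb hβ0 hβ.ne' hn0]
    rw [← Real.rpow_mul hβ0.le, hε, mul_left_comm, mul_one_div_cancel hL.ne', mul_one]
    exact_mod_cast Real.rpow_natCast β 8
  refine bellValue_le (by positivity) fun P hP => ?_
  refine ((pairValueLE_kvGame h0 h1).abs_pairing_threePair_le (by positivity)
    (isDominated_kvGame h0 (by linarith)) (kvGame_symm _) hP).trans ?_
  rw [← hn, ← hnε, ← Real.rpow_two, ← Real.rpow_sub hn0]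
  refine Real.rpow_le_rpow_of_exponent_le hn1.le ?_
  have hp : 2 * (1 - kvNoise β l) = 1 + 2 * ε := by rw [hη]; ring
  rw [hp, sub_le_sub_iff, ← sub_le_iff_le_add, ← sub_nonneg]
  have : 8 * ε + 4 / (1 + 2 * ε) - (2 + 2 - 0) = 16 * ε ^ 2 / (1 + 2 * ε) := by
    field_simp
    ring
  have h2 : 0 ≤ 16 * ε ^ 2 / (1 + 2 * ε) := by positivity
  linarith

lemma exists_quantumOfDim_le_pairing_kvTripartite {β : ℝ} (hβ : 1 < β) {l : ℕ} (hl : 1 ≤ l)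
    (h0 : 0 ≤ kvNoise β l) :
    ∃ P ∈ quantumOfDim (KVQuestion l × KVQuestion l) (KVAnswer l × KVAnswer l)
        ((2 ^ l) ^ 2) ((2 ^ l) ^ 2) ((2 ^ l) ^ 2),
      64 * Real.log β ^ 6 / Real.log ((2 : ℝ) ^ l) ^ 6 ≤ |pairing (kvTripartite β l) P| := by
  have hcard : Fintype.card (Fin ((2 ^ l) ^ 2)) =
      Fintype.card ((Fin l → ZMod 2) × (Fin l → ZMod 2)) := by
    rw [Fintype.card_fin, Fintype.card_prod,
      show Fintype.card (Fin l → ZMod 2) = 2 ^ l from card_kvAnswer l, sq]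
  refine ⟨_, threePair_entangledProb_mem_quantumOfDim (isBasisFamily_kvVector l)
    (Fintype.equivOfCardEq hcard), ?_⟩
  refine le_trans (le_trans (le_of_eq ?_) (le_pairing_entangledProb h0
    (by linarith [kvNoise_lt_half hβ hl]))) (le_abs_self _)
  have hlogβ : 0 < Real.log β := Real.log_pos hβ
  have hlogn : 0 < Real.log ((2 : ℝ) ^ l) := Real.log_pos (one_lt_pow₀ one_lt_two (by omega))
  have : 1 - 2 * kvNoise β l = 2 * (Real.log β / Real.log ((2 : ℝ) ^ l)) := by
    rw [kvNoise, Real.logb, one_div_div]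
    ring
  rw [this, mul_pow, div_pow]
  ring

/-- The violation is `Ω(n² / log⁶ n)`. -/
lemma kvTripartite_violation {β : ℝ} (hβ : 1 < β) {l : ℕ} (hl : 1 ≤ l) (h0 : 0 ≤ kvNoise β l) :
    0 < bellValue (generalBilocal _ _) (kvTripartite β l) ∧
    64 * Real.log β ^ 6 / β ^ 8 * (((2 : ℝ) ^ l) ^ 2 / Real.log ((2 : ℝ) ^ l) ^ 6) ≤
      bellValue (quantum _ _) (kvTripartite β l) /
        bellValue (generalBilocal _ _) (kvTripartite β l) ∧
    ∃ P ∈ quantumOfDim (KVQuestion l × KVQuestion l) (KVAnswer l × KVAnswer l)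
        ((2 ^ l) ^ 2) ((2 ^ l) ^ 2) ((2 ^ l) ^ 2),
      64 * Real.log β ^ 6 / β ^ 8 * (((2 : ℝ) ^ l) ^ 2 / Real.log ((2 : ℝ) ^ l) ^ 6) ≤
        |pairing (kvTripartite β l) P| /
          bellValue (generalBilocal _ _) (kvTripartite β l) := by
  obtain ⟨P, hP, hval⟩ := exists_quantumOfDim_le_pairing_kvTripartite hβ hl h0
  have hG := (isGame_kvTripartite hβ hl h0).1
  have hB := bellValue_generalBilocal_kvTripartite_le hβ hl h0
  have hPq : P ∈ quantum (KVQuestion l × KVQuestion l) (KVAnswer l × KVAnswer l) :=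
    ⟨_, _, _, hP⟩
  have hPle : |pairing (kvTripartite β l) P| ≤ bellValue (quantum _ _) (kvTripartite β l) :=
    abs_pairing_le_bellValue (fun _ h => abs_pairing_quantum_le hG h) hPq
  have hlogβ : 0 < Real.log β := Real.log_pos hβ
  have hlogn : 0 < Real.log ((2 : ℝ) ^ l) := Real.log_pos (one_lt_pow₀ one_lt_two (by omega))
  have hval0 : 0 < |pairing (kvTripartite β l) P| := lt_of_lt_of_le (by positivity) hval
  -- The upper bound by the number of outputs forces the bilocal value to be positive once one
  -- quantum value is.
  have hpos : 0 < bellValue (generalBilocal _ _) (kvTripartite β l) := by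
    by_contra h
    have h' := abs_pairing_quantum_le hG hPq
    rw [le_antisymm (not_lt.1 h) (bellValue_nonneg _ _), mul_zero] at h'
    exact absurd hval0 (not_lt.2 h')
  have key : 64 * Real.log β ^ 6 / β ^ 8 * (((2 : ℝ) ^ l) ^ 2 / Real.log ((2 : ℝ) ^ l) ^ 6) ≤
      |pairing (kvTripartite β l) P| / bellValue (generalBilocal _ _) (kvTripartite β l) := by
    have hβ0 : 0 < β := by linarith
    rw [le_div_iff₀ hpos]
    refine le_trans (mul_le_mul_of_nonneg_left hB (by positivity)) (le_trans (le_of_eq ?_) hval)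
    field_simp
  exact ⟨hpos, key.trans (by gcongr), P, hP, key⟩

lemma tendsto_sq_div_log_pow_atTop :
    Filter.Tendsto (fun l : ℕ => ((2 : ℝ) ^ l) ^ 2 / Real.log ((2 : ℝ) ^ l) ^ 6)
      Filter.atTop Filter.atTop := by
  have h2 : Filter.Tendsto (fun l : ℕ => (2 : ℝ) ^ l) Filter.atTop Filter.atTop :=
    tendsto_pow_atTop_atTop_of_one_lt one_lt_two
  refine Filter.Tendsto.comp (g := fun x : ℝ => x ^ 2 / Real.log x ^ 6) ?_ h2
  -- Eventually `log⁶ x ≤ x`, so the quotient is at least `x`.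
  refine Filter.tendsto_atTop_mono' _ ?_ Filter.tendsto_id
  filter_upwards [(Real.isLittleO_pow_log_id_atTop (n := 6)).bound one_pos,
    Filter.eventually_gt_atTop 1] with x hx hx1
  have hlog : 0 < Real.log x := Real.log_pos hx1
  have hx0 : 0 < x := by linarith
  simp only [id, Real.norm_eq_abs, one_mul, abs_of_pos hx0, abs_of_pos (pow_pos hlog 6)] at hx ⊢
  rw [le_div_iff₀ (by positivity), sq]
  gcongr

lemma eventually_kvNoise_nonneg {β : ℝ} (hβ : 1 < β) :
    ∀ᶠ l : ℕ in Filter.atTop, 0 ≤ kvNoise β l := by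
  have h2 : Filter.Tendsto (fun l : ℕ => (2 : ℝ) ^ l) Filter.atTop Filter.atTop :=
    tendsto_pow_atTop_atTop_of_one_lt one_lt_two
  filter_upwards [((Real.tendsto_logb_atTop hβ).comp h2).eventually_ge_atTop 2] with l hl
  have : 1 / Real.logb β ((2 : ℝ) ^ l) ≤ 1 / 2 := one_div_le_one_div_of_le two_pos hl
  rw [kvNoise]
  linarith

end

theorem mainTheorem1 :
    -- the game, its parameters and its violation, for each base `β` of the logarithm in the noise rate
    (∀ β : ℝ, 1 < β →
      (∃ C : ℝ, 0 < C ∧ ∀ l n : ℕ, n = 2 ^ l → 0 ≤ kvNoise β l → 1 ≤ l →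
        (Fintype.card (KVQuestion l × KVQuestion l) : ℝ) = ((2 : ℝ) ^ n / n) ^ 2 ∧
        Fintype.card (KVAnswer l × KVAnswer l) = n ^ 2 ∧
        IsGame (kvTripartite β l) ∧
        0 < bellValue (generalBilocal _ _) (kvTripartite β l) ∧
        C * ((n : ℝ) ^ 2 / Real.log n ^ 6) ≤
          bellValue (quantum _ _) (kvTripartite β l) /
            bellValue (generalBilocal _ _) (kvTripartite β l) ∧
        ∃ P ∈ quantumOfDim (KVQuestion l × KVQuestion l) (KVAnswer l × KVAnswer l)
            (n ^ 2) (n ^ 2) (n ^ 2),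
          C * ((n : ℝ) ^ 2 / Real.log n ^ 6) ≤
            |pairing (kvTripartite β l) P| /
              bellValue (generalBilocal _ _) (kvTripartite β l)) ∧
      Filter.Tendsto
        (fun l : ℕ => bellValue (quantum _ _) (kvTripartite β l) /
          bellValue (generalBilocal _ _) (kvTripartite β l))
        Filter.atTop Filter.atTop) ∧
    -- optimality in the local dimension
    (∀ (X A : Type) [Fintype X] [Fintype A] (G : Table₃ X A) (d : ℕ), IsGame G →
      bellValue (quantumOneDim X A d) G ≤ d * bellValue (generalBilocal X A) G) ∧
    -- optimality in the number of outputs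
    (∀ (X A : Type) [Fintype X] [Fintype A] (G : Table₃ X A), IsGame G →
      bellValue (quantum X A) G ≤ Fintype.card A * bellValue (generalBilocal X A) G) := by
  refine ⟨fun β hβ => ?_, fun X A _ _ G d hG => bellValue_quantumOneDim_le hG.1 d,
    fun X A _ _ G hG => bellValue_quantum_le hG.1⟩
  have hlogβ : 0 < Real.log β := Real.log_pos hβ
  -- The numerator comes from `(1 - 2η)^6 = (2 log β / log n)^6`, the denominator from the bilocal
  -- bound `β^8/n²`.
  have hC : 0 < 64 * Real.log β ^ 6 / β ^ 8 := by positivity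
  refine ⟨⟨_, hC, ?_⟩, ?_⟩
  · rintro l n rfl h0 hl
    obtain ⟨hpos, hq, hP⟩ := kvTripartite_violation hβ hl h0
    refine ⟨?_, ?_, isGame_kvTripartite hβ hl h0, hpos, ?_, ?_⟩
    · have h : (Fintype.card (KVQuestion l) : ℝ) * 2 ^ l = 2 ^ 2 ^ l := by
        exact_mod_cast card_kvQuestion_mul l
      rw [Fintype.card_prod, ← h]
      push_cast
      rw [mul_div_cancel_right₀ _ (by positivity), sq]
    · rw [Fintype.card_prod, card_kvAnswer, sq]
    · exact_mod_cast hq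
    · exact_mod_cast hP
  · refine Filter.tendsto_atTop_mono' _ ?_ (tendsto_sq_div_log_pow_atTop.const_mul_atTop hC)
    filter_upwards [eventually_kvNoise_nonneg hβ, Filter.eventually_ge_atTop 1] with l h0 hl
    exact (kvTripartite_violation hβ hl h0).2.1
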